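/- A Polish group is TSI if it admits a compatible two-sided invariant metric. It is strongly NSS if there is an open set $V\ni 1$ such that for every sequence $(g_n)$ that does not converge to $1$ there are $n_0<\dots<n_k$ with $g_{n_0}\cdots g_{n_k}\notin V$. For a Polish group $G$ and $x,y\in G^\omega$ put: - $x\,E(G)\,y$ iff $\lim_n x(n)y(n)^{-1}$ exists in $G$; - $x\,E_*(G)\,y$ iff $\lim_n x(0)\cdots x(n)\,y(n)^{-1}\cdots y(0)^{-1}$ exists in $G$; - $x\,E(G;0)\,y$ iff $\lim_n x(n)^{-1}y(n)=1_G$ (equivalently, $\lim_n d(x(n),y(n))=0$ for any compatible left-invariant metric $d$). Let $E,F$ be equivalence relations on $X,Y$. A map $f:X\to Y$ is an $(E,F)$-homomorphism if $x\,E\,y$ implies $f(x)\,F\,f(y)$, and a reduction of $E$ to $F$ if $x\,E\,y\iff f(x)\,F\,f(y)$. If $X,Y$ are Polish spaces, $E\le_B F$ means that there is a Borel reduction of $E$ to $F$. The relation $E\times F$ on $X\times Y$ is defined coordinatewise. For a map $S:X\to Y$ and $x\in X^\omega$ let $S^\omega(x)=(S(x(n)))_n\in Y^\omega$ and $S^\#(x)=(S^\omega(x),x)\in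 Y^\omega\times X^\omega$. **Theorem (Pre-rigid Theorem).** Let $G$ be a TSI Polish group and let $H$ be a closed subgroup of $\prod_{m\in\omega}H_m$, where every $H_m$ is a TSI strongly NSS Polish group. If $E(G)\le_B E(H)$, then there are open subgroups $W_m$ of $G$ and continuous maps $\pi_m:W_m\to H_m$ with $\pi_m(1_G)=1_{H_m}$ $(m\in\omega)$ such that (i) for every $m$, the map $\pi_m^\omega:W_m^\omega\to H_m^\omega$ is an $(E_*(W_m),E_*(H_m))$-homomorphism; (ii) with $W=\bigcap_m W_m$, the formula $S(g)=(\pi_0(g),\pi_1(g),\dots)$ defines a map $S:W\to H$ (that is, $S(g)\in H$ for all $g\in W$), and $S^\#:W^\omega\to H^\omega\times W^\omega$ is a reduction of $E_*(W)$ to $E_*(H)\times E(W;0)$. Conversely, if there are such $W_m$ and $\pi_m$ (open subgroups and continuous maps fixing the identity, with (i) and (ii)) for which $W=\bigcap_m W_m=G$, and if the interval $[0,1]$ embeds topologically into $H$, then $E(G)\le_B E(H)$. -/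

import Mathlib

open Filter Topology

namespace TSIPolish

section Reductions

variable {X Y : Type*}

/-- `f` is an `(E, F)`-homomorphism: `x E y` implies `f x F f y`. -/
def IsHom (E : Setoid X) (F : Setoid Y) (f : X → Y) : Prop :=
  ∀ x y : X, E x y → F (f x) (f y)

/-- `f` is a reduction of `E` to `F`: `x E y` if and only if `f x F f y`. -/
def IsReduction (E : Setoid X) (F : Setoid Y) (f : X → Y) : Prop :=
  ∀ x y : X, E x y ↔ F (f x) (f y)

/-- `E` is Borel reducible to `F`: there is a reduction which is measurable with respect to the
Borel σ-algebras. -/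
def BorelReducible [TopologicalSpace X] [TopologicalSpace Y] (E : Setoid X) (F : Setoid Y) : Prop :=
  ∃ f : X → Y, @Measurable X Y (borel X) (borel Y) f ∧ IsReduction E F f

/-- The map `S^ω : X^ω → Y^ω`, acting coordinatewise. -/
def omegaMap (S : X → Y) (x : ℕ → X) : ℕ → Y := fun n => S (x n)

/-- The map `S^# : X^ω → Y^ω × X^ω`, `x ↦ (S^ω(x), x)`. -/
def sharpMap (S : X → Y) (x : ℕ → X) : (ℕ → Y) × (ℕ → X) := (omegaMap S x, x)

end Reductions

section Groups

variable (G : Type*) [Group G] [TopologicalSpace G]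

/-- `G` is TSI: its topology is given by a two-sided invariant metric. -/
def IsTSI : Prop :=
  ∃ d : MetricSpace G, d.toUniformSpace.toTopologicalSpace = ‹TopologicalSpace G› ∧
    (∀ g h k : G, d.dist (g * h) (g * k) = d.dist h k) ∧
    (∀ g h k : G, d.dist (h * g) (k * g) = d.dist h k)

/-- `G` is strongly NSS: it has an open neighbourhood `V` of the identity such that every sequence
which does not converge to the identity has a product `g (n 0) * ⋯ * g (n k)`, with
`n 0 < ⋯ < n k`, outside `V`. -/
def IsStronglyNSS : Prop :=
  ∃ V : Set G, IsOpen V ∧ (1 : G) ∈ V ∧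
    ∀ g : ℕ → G, ¬ Tendsto g atTop (𝓝 1) →
      ∃ (k : ℕ) (n : Fin (k + 1) → ℕ), StrictMono n ∧ (List.ofFn fun i => g (n i)).prod ∉ V

/-- The product `x 0 * x 1 * ⋯ * x n`, in this order. -/
def partialProd {G : Type*} [Group G] (x : ℕ → G) (n : ℕ) : G :=
  ((List.range (n + 1)).map x).prod

variable [IsTopologicalGroup G]

/-- The equivalence relation `E(G)` on `G^ω`: `x n * (y n)⁻¹` converges in `G`. -/
def E : Setoid (ℕ → G) where
  r x y := ∃ g : G, Tendsto (fun n => x n * (y n)⁻¹) atTop (𝓝 g)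
  iseqv :=
    { refl := fun x => ⟨1, by simpa using tendsto_const_nhds⟩
      symm := by
        rintro x y ⟨g, hg⟩
        exact ⟨g⁻¹, by simpa using hg.inv⟩
      trans := by
        rintro x y z ⟨g, hg⟩ ⟨h, hh⟩
        exact ⟨g * h, by simpa [mul_assoc] using hg.mul hh⟩ }

/-- The equivalence relation `E_*(G)` on `G^ω`:
`x 0 * ⋯ * x n * (y n)⁻¹ * ⋯ * (y 0)⁻¹` converges in `G`. -/
def EStar : Setoid (ℕ → G) where
  r x y := ∃ g : G, Tendsto (fun n => partialProd x n * (partialProd y n)⁻¹) atTop (𝓝 g)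
  iseqv :=
    { refl := fun x => ⟨1, by simpa using tendsto_const_nhds⟩
      symm := by
        rintro x y ⟨g, hg⟩
        exact ⟨g⁻¹, by simpa using hg.inv⟩
      trans := by
        rintro x y z ⟨g, hg⟩ ⟨h, hh⟩
        exact ⟨g * h, by simpa [mul_assoc] using hg.mul hh⟩ }

/-- The equivalence relation `E(G;0)` on `G^ω`: `(x n)⁻¹ * y n` converges to the identity. By
`eZero_iff_dist` below this says that `d (x n) (y n)` tends to `0`, for any compatible
left-invariant metric `d`. -/
def EZero : Setoid (ℕ → G) where
  r x y := Tendsto (fun n => (x n)⁻¹ * y n) atTop (𝓝 1)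
  iseqv :=
    { refl := fun x => by simpa using tendsto_const_nhds
      symm := by
        intro x y h
        simpa using h.inv
      trans := by
        intro x y z h h'
        simpa [mul_assoc] using h.mul h' }

variable {G}

theorem eZero_iff_dist (d : MetricSpace G)
    (hd : d.toUniformSpace.toTopologicalSpace = ‹TopologicalSpace G›)
    (hl : ∀ g h k : G, d.dist (g * h) (g * k) = d.dist h k) (x y : ℕ → G) :
    EZero G x y ↔ Tendsto (fun n => d.dist (x n) (y n)) atTop (𝓝 0) := by
  subst hd
  have h1 : ∀ n, d.dist (x n) (y n) = d.dist ((x n)⁻¹ * y n) 1 := by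
    intro n
    rw [← hl (x n)⁻¹, inv_mul_cancel]
    exact dist_comm _ _
  simp only [h1]
  exact tendsto_iff_dist_tendsto_zero

end Groups

section System

variable {G : Type*} [Group G] [TopologicalSpace G] [IsTopologicalGroup G]
  {Hm : ℕ → Type*} [∀ m, Group (Hm m)] [∀ m, TopologicalSpace (Hm m)]
  [∀ m, IsTopologicalGroup (Hm m)]

/-- The maps `p m : W m → Hm m` have a combined map `S : ⋂ m, W m → H`, `S g = (p m g)_m`, with
values in `H`, and `S^#` is a reduction of `E_*(⋂ m, W m)` to `E_*(H) × E(⋂ m, W m; 0)`. -/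
def CombinedSharpReduces (H : Subgroup (∀ m, Hm m)) (W : ℕ → Subgroup G)
    (p : ∀ m, W m → Hm m) : Prop :=
  ∃ S : ↥(⨅ m, W m) → H,
    (∀ (g : ↥(⨅ m, W m)) (m : ℕ),
      (S g : ∀ m, Hm m) m = p m ⟨(g : G), Subgroup.mem_iInf.1 g.2 m⟩) ∧
    IsReduction (EStar ↥(⨅ m, W m)) ((EStar H).prod (EZero ↥(⨅ m, W m))) (sharpMap S)

/-- A sequence of open subgroups `W m` of `G` with continuous maps `p m : W m → Hm m` that fix the
identity, such that every `(p m)^ω` is an `(E_*(W m), E_*(Hm m))`-homomorphism, and `S^#` is a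
reduction of `E_*(W)` to `E_*(H) × E(W;0)` for `W = ⋂ m, W m` and the combined map `S : W → H`. -/
def IsPreRigid (H : Subgroup (∀ m, Hm m)) (W : ℕ → Subgroup G) (p : ∀ m, W m → Hm m) : Prop :=
  (∀ m, IsOpen (W m : Set G)) ∧
  (∀ m, Continuous (p m)) ∧
  (∀ m, p m 1 = 1) ∧
  (∀ m, IsHom (EStar (W m)) (EStar (Hm m)) (omegaMap (p m))) ∧
  CombinedSharpReduces H W p

end System

end TSIPolish

/-! A TSI Polish group carries a conjugation-invariant length `ν` that induces its topology and is
complete (`exists_tendsto_of_isCau`). Both `E` and `E_*` then say that a sequence of ratios is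
Cauchy. Invariance makes the ratio of partial products insensitive to summable changes of the
factors (`isCau_rat_congr`) and to inserted trivial factors (`isCau_rat_spread`).

Forward direction. Restrict the reduction to sequences from a countable dense subgroup D of G, taken
as a discrete group. A Baire category construction (`exists_filler`) gives a point z and sparse
positions. Multiply z by the step function whose values are the partial products of x, where each x
n lies in a prescribed finite set. The image under the reduction then splits into blocks, and, up to
a summable error, the n-th block of increments depends on x n alone. So there are maps M n : D → H
such that the ratios of x, y are Cauchy iff those of the images M n (x n), M n (y n) are Cauchy and
the oscillation Δ inside the blocks tends to 0 (`exists_blocks`, `exists_asympReduction`).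

In a strongly NSS coordinate H_m the maps M n converge near the identity. For triples with uvw = 1,
the property M_a(u) M_b(v) M_c(w) → 1 passes to nearby triples (`exists_tends3`): otherwise NSS
would multiply bad triples to a product of length at least η, although `uniform` keeps it close to a
product of good triples. Starting from (1, 1, 1), this reaches (d, 1, d⁻¹) for all d in D near a
point of the subgroup generated by a small ball, and it forces M n (d) to be Cauchy. The limit as n
→ ∞ and d → g is π_m(g). Replacing points of G by elements of D at sparse positions, with summable
errors, carries the homomorphism and reduction properties to the limits. The condition Δ → 0 is
where E(W;0) enters.

Converse. Passing to increments identifies E(G) with E_*(G), which S^# reduces to E_*(H) × E(G;0).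
The second factor reduces to convergence of distances to 0 in [0,1]^ω
(`exists_reduction_unitInterval`), hence in H by the embedding, and interleaving merges both
conditions into one instance of E(H). -/

namespace TSIPolish

/-! ### Partial products and their behaviour under sparse placement -/

section Combinatorics

/-- The product `u 0 * ⋯ * u (n - 1)`. -/
def pp {A : Type*} [Group A] (u : ℕ → A) : ℕ → A
  | 0 => 1
  | n + 1 => pp u n * u n

@[simp] theorem pp_zero {A : Type*} [Group A] (u : ℕ → A) : pp u 0 = 1 := rfl

theorem pp_succ {A : Type*} [Group A] (u : ℕ → A) (n : ℕ) : pp u (n + 1) = pp u n * u n := rfl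

theorem partialProd_eq_pp {A : Type*} [Group A] (u : ℕ → A) (n : ℕ) :
    partialProd u n = pp u (n + 1) := by
  induction n with
  | zero => simp [partialProd, pp_succ]
  | succ n ih =>
    rw [pp_succ, ← ih]
    simp [partialProd, List.range_succ (n := n + 1)]

theorem map_pp {A B : Type*} [Group A] [Group B] (φ : A →* B) (u : ℕ → A) (n : ℕ) :
    φ (pp u n) = pp (fun i => φ (u i)) n := by
  induction n with
  | zero => simp
  | succ n ih => simp [pp_succ, ih]

theorem pp_congr {A : Type*} [Group A] {u v : ℕ → A} {n : ℕ} (h : ∀ i < n, u i = v i) :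
    pp u n = pp v n := by
  induction n with
  | zero => rfl
  | succ n ih => rw [pp_succ, pp_succ, ih fun i hi => h i (by omega), h n (by omega)]

theorem pp_of_one {A : Type*} [Group A] {u : ℕ → A} {a n : ℕ} (han : a ≤ n)
    (h : ∀ i, a ≤ i → i < n → u i = 1) : pp u n = pp u a := by
  induction n, han using Nat.le_induction with
  | base => rfl
  | succ n hn ih => rw [pp_succ, h n hn (by omega), mul_one, ih fun i hi hi' => h i hi (by omega)]

@[simp] theorem pp_one {A : Type*} [Group A] (n : ℕ) : pp (fun _ => (1 : A)) n = 1 := by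
  simpa using pp_of_one (A := A) (u := fun _ => 1) (Nat.zero_le n) (by simp)

/-- The ratio of the partial products of two sequences. -/
def rat {A : Type*} [Group A] (u v : ℕ → A) (n : ℕ) : A := pp u n * (pp v n)⁻¹

/-- The number of values of a strictly increasing sequence `p` below `i`. -/
noncomputable def jdx (p : ℕ → ℕ) (i : ℕ) : ℕ := sInf {n | i ≤ p n}

theorem lt_jdx {p : ℕ → ℕ} (hp : StrictMono p) {n i : ℕ} : n < jdx p i ↔ p n < i := by
  have hne : {n | i ≤ p n}.Nonempty := ⟨i, hp.id_le i⟩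
  constructor
  · intro h
    exact not_le.1 fun h' => absurd (Nat.sInf_le (show n ∈ {n | i ≤ p n} from h')) (not_le.2 h)
  · intro h
    by_contra hcon
    have h1 : i ≤ p (jdx p i) := Nat.sInf_mem hne
    exact absurd (h1.trans (hp.monotone (not_lt.1 hcon))) (not_le.2 h)

theorem jdx_apply {p : ℕ → ℕ} (hp : StrictMono p) (n : ℕ) : jdx p (p n) = n :=
  eq_of_forall_lt_iff fun m => by rw [lt_jdx hp, hp.lt_iff_lt]

theorem jdx_apply_succ {p : ℕ → ℕ} (hp : StrictMono p) (n : ℕ) : jdx p (p n + 1) = n + 1 :=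
  eq_of_forall_lt_iff fun m => by
    rw [lt_jdx hp, Nat.lt_succ_iff, Nat.lt_succ_iff, hp.le_iff_le]

theorem jdx_succ_of_not_mem {p : ℕ → ℕ} (hp : StrictMono p) {i : ℕ} (h : i ∉ Set.range p) :
    jdx p (i + 1) = jdx p i :=
  eq_of_forall_lt_iff fun m => by
    rw [lt_jdx hp, lt_jdx hp, Nat.lt_succ_iff]
    exact ⟨fun h' => lt_of_le_of_ne h' fun h'' => h ⟨m, h''⟩, le_of_lt⟩

theorem tendsto_jdx {p : ℕ → ℕ} (hp : StrictMono p) : Tendsto (jdx p) atTop atTop := by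
  refine tendsto_atTop.2 fun n => eventually_atTop.2 ⟨p n, fun i hi => ?_⟩
  by_contra h
  have : jdx p i < n := not_le.1 h
  have h2 : ¬ (jdx p i < jdx p i) := lt_irrefl _
  rw [lt_jdx hp] at h2
  have := hp this
  omega

/-- The sequence with value `x n` at position `p n`, and `1` elsewhere. -/
noncomputable def spread {A : Type*} [One A] (p : ℕ → ℕ) (x : ℕ → A) : ℕ → A :=
  Function.extend p x fun _ => 1

theorem spread_apply {A : Type*} [One A] {p : ℕ → ℕ} (hp : StrictMono p) (x : ℕ → A) (n : ℕ) :
    spread p x (p n) = x n := hp.injective.extend_apply _ _ _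

theorem spread_of_not_mem {A : Type*} [One A] {p : ℕ → ℕ} (x : ℕ → A) {i : ℕ}
    (h : i ∉ Set.range p) : spread p x i = 1 := Function.extend_apply' _ _ _ h

/-- Trivial factors only reindex partial products. This allows a sequence to be moved to arbitrarily
sparse positions. -/
theorem pp_spread {A B : Type*} [One A] [Group B] {p : ℕ → ℕ} (hp : StrictMono p)
    (M : ℕ → A → B) (hM : ∀ i, M i 1 = 1) (x : ℕ → A) (i : ℕ) :
    pp (fun i => M i (spread p x i)) i = pp (fun n => M (p n) (x n)) (jdx p i) := by
  induction i with
  | zero =>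
    have : jdx p 0 = 0 := eq_of_forall_lt_iff fun m => by rw [lt_jdx hp]; simp
    rw [this]; rfl
  | succ i ih =>
    by_cases h : i ∈ Set.range p
    · obtain ⟨n, rfl⟩ := h
      rw [pp_succ, ih, jdx_apply hp, jdx_apply_succ hp, pp_succ, spread_apply hp]
    · rw [pp_succ, ih, spread_of_not_mem _ h, hM, mul_one, jdx_succ_of_not_mem hp h]

end Combinatorics

/-! ### Conjugation-invariant lengths and Cauchy ratios -/

/-- A length function on a group that is invariant under conjugation. -/
structure InvLength (A : Type*) [Group A] where
  toFun : A → ℝ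
  map_one' : toFun 1 = 0
  map_inv' : ∀ a, toFun a⁻¹ = toFun a
  map_mul_le' : ∀ a b, toFun (a * b) ≤ toFun a + toFun b
  map_conj' : ∀ a b, toFun (b * a * b⁻¹) = toFun a

namespace InvLength

section Basic

variable {A B : Type*} [Group A] [Group B] (ν : InvLength A)

instance : CoeFun (InvLength A) fun _ => A → ℝ := ⟨toFun⟩

@[simp] theorem map_one : ν 1 = 0 := ν.map_one'
@[simp] theorem map_inv (a : A) : ν a⁻¹ = ν a := ν.map_inv' a
theorem map_mul_le (a b : A) : ν (a * b) ≤ ν a + ν b := ν.map_mul_le' a b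

theorem map_nonneg (a : A) : 0 ≤ ν a := by
  have h := ν.map_mul_le a a⁻¹
  rw [mul_inv_cancel, map_one, map_inv] at h
  linarith

theorem eq_of_conj (c : A) {a b : A} (h : a = c * b * c⁻¹) : ν a = ν b := by
  rw [h]; exact ν.map_conj' b c

theorem map_mul_comm (a b : A) : ν (a * b) = ν (b * a) := ν.eq_of_conj a (by group)

theorem map_div_comm (a b : A) : ν (a * b⁻¹) = ν (b * a⁻¹) := by
  rw [← map_inv]; congr 1; group

theorem map_inv_mul (a b : A) : ν (a⁻¹ * b) = ν (a * b⁻¹) := by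
  rw [map_mul_comm, map_div_comm]

theorem triangle (a b c : A) : ν (a * c⁻¹) ≤ ν (a * b⁻¹) + ν (b * c⁻¹) := by
  have := ν.map_mul_le (a * b⁻¹) (b * c⁻¹)
  rwa [show a * b⁻¹ * (b * c⁻¹) = a * c⁻¹ by group] at this

theorem map_mul_mul_le (a b a' b' : A) :
    ν (a * b * (a' * b')⁻¹) ≤ ν (a * a'⁻¹) + ν (b * b'⁻¹) := by
  have := ν.map_mul_le (a * (b * b'⁻¹) * a⁻¹) (a * a'⁻¹)
  rw [ν.map_conj'] at this
  rw [show a * b * (a' * b')⁻¹ = a * (b * b'⁻¹) * a⁻¹ * (a * a'⁻¹) by group]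
  linarith

theorem map_le_add (a b : A) : ν a ≤ ν (a * b⁻¹) + ν b := by
  simpa using ν.map_mul_le (a * b⁻¹) b

/-- The length function induced by a homomorphism. -/
def comap (φ : B →* A) : InvLength B where
  toFun b := ν (φ b)
  map_one' := by simp
  map_inv' b := by simp
  map_mul_le' a b := by simpa using ν.map_mul_le (φ a) (φ b)
  map_conj' a b := by simpa using ν.map_conj' (φ a) (φ b)

@[simp] theorem comap_apply (φ : B →* A) (b : B) : ν.comap φ b = ν (φ b) := rfl

/-- `r` is a Cauchy sequence. -/
def IsCau (r : ℕ → A) : Prop := ∀ ε > 0, ∃ N, ∀ n ≥ N, ν (r n * (r N)⁻¹) < ε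

variable {ν}

theorem IsCau.two {r : ℕ → A} (h : ν.IsCau r) {ε : ℝ} (hε : 0 < ε) :
    ∃ N, ∀ n ≥ N, ∀ m ≥ N, ν (r n * (r m)⁻¹) < ε := by
  obtain ⟨N, hN⟩ := h (ε / 2) (half_pos hε)
  refine ⟨N, fun n hn m hm => ?_⟩
  have h1 := ν.triangle (r n) (r N) (r m)
  have h2 := hN n hn
  have h3 := hN m hm
  rw [map_div_comm] at h3
  linarith

theorem IsCau.comp {r : ℕ → A} (h : ν.IsCau r) {φ : ℕ → ℕ} (hφ : Tendsto φ atTop atTop) :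
    ν.IsCau fun n => r (φ n) := by
  intro ε hε
  obtain ⟨N, hN⟩ := h.two hε
  obtain ⟨K, hK⟩ := eventually_atTop.1 (tendsto_atTop.1 hφ N)
  exact ⟨K, fun n hn => hN _ (hK n hn) _ (hK K le_rfl)⟩

theorem IsCau.of_succ {r : ℕ → A} (h : ν.IsCau fun n => r (n + 1)) : ν.IsCau r := by
  intro ε hε
  obtain ⟨N, hN⟩ := h ε hε
  refine ⟨N + 1, fun n hn => ?_⟩
  obtain ⟨m, rfl⟩ : ∃ m, n = m + 1 := ⟨n - 1, by omega⟩
  exact hN m (by omega)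

theorem isCau_succ_iff {r : ℕ → A} : (ν.IsCau fun n => r (n + 1)) ↔ ν.IsCau r :=
  ⟨IsCau.of_succ, fun h => h.comp (tendsto_add_atTop_nat 1)⟩

theorem IsCau.mul {r s : ℕ → A} (hr : ν.IsCau r) (hs : ν.IsCau s) :
    ν.IsCau fun n => r n * s n := by
  intro ε hε
  obtain ⟨N, hN⟩ := hr.two (half_pos hε)
  obtain ⟨K, hK⟩ := hs.two (half_pos hε)
  refine ⟨max N K, fun n hn => ?_⟩
  have h1 := hN n (by omega) (max N K) (by omega)
  have h2 := hK n (by omega) (max N K) (by omega)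
  have := ν.map_mul_mul_le (r n) (s n) (r (max N K)) (s (max N K))
  linarith

theorem IsCau.inv {r : ℕ → A} (hr : ν.IsCau r) : ν.IsCau fun n => (r n)⁻¹ := by
  intro ε hε
  obtain ⟨N, hN⟩ := hr ε hε
  refine ⟨N, fun n hn => ?_⟩
  rw [inv_inv, ν.map_inv_mul]
  exact hN n hn

variable (ν)

theorem isCau_const (a : A) : ν.IsCau fun _ => a := fun ε hε => ⟨0, fun n _ => by simpa using hε⟩

theorem isCau_of_summable {r : ℕ → A} {e : ℕ → ℝ} (he : Summable e)
    (h : ∀ n, ν (r (n + 1) * (r n)⁻¹) ≤ e n) : ν.IsCau r := by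
  intro ε hε
  obtain ⟨N, hN⟩ := Metric.cauchySeq_iff'.1 he.hasSum.tendsto_sum_nat.cauchySeq ε hε
  refine ⟨N, fun n hn => ?_⟩
  have key : ν (r n * (r N)⁻¹) ≤ ∑ i ∈ Finset.range n, e i - ∑ i ∈ Finset.range N, e i := by
    induction n, hn using Nat.le_induction with
    | base => simp
    | succ n hn ih =>
      have := ν.triangle (r (n + 1)) (r n) (r N)
      rw [Finset.sum_range_succ]
      linarith [h n]
  have := hN n hn
  rw [Real.dist_eq] at this
  linarith [le_abs_self (∑ i ∈ Finset.range n, e i - ∑ i ∈ Finset.range N, e i)]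

/-- The quotient of consecutive ratios is the conjugate of `u n * (v n)⁻¹` by `pp u n`, so
invariance removes the dependence on the past. -/
theorem isCau_rat_of_summable {u v : ℕ → A} {e : ℕ → ℝ} (he : Summable e)
    (h : ∀ n, ν (u n * (v n)⁻¹) ≤ e n) : ν.IsCau (rat u v) := by
  refine ν.isCau_of_summable he fun n => ?_
  rw [ν.eq_of_conj (pp u n) (b := u n * (v n)⁻¹) (by simp only [rat, pp_succ]; group)]
  exact h n

/-- Changing two sequences by summable amounts does not affect convergence of the ratio. -/
theorem isCau_rat_congr {u v u' v' : ℕ → A} {e : ℕ → ℝ} (he : Summable e)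
    (hu : ∀ n, ν (u n * (u' n)⁻¹) ≤ e n) (hv : ∀ n, ν (v n * (v' n)⁻¹) ≤ e n)
    (h : ν.IsCau (rat u v)) : ν.IsCau (rat u' v') := by
  -- The new ratio factors as `(rat u u')⁻¹ * rat u v * rat v v'`.
  have h1 := (ν.isCau_rat_of_summable he hu).inv
  have h2 := ν.isCau_rat_of_summable he hv
  convert (h1.mul h).mul h2 using 2 with n
  simp only [rat]; group

/-- The same conjugation, read backwards. It shows that E_* implies the E(·;0) component of the
target. -/
theorem tendsto_of_isCau_rat {u v : ℕ → A} (h : ν.IsCau (rat u v)) :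
    Tendsto (fun n => ν (u n * (v n)⁻¹)) atTop (𝓝 0) := by
  rw [Metric.tendsto_atTop]
  intro ε hε
  obtain ⟨N, hN⟩ := h.two hε
  refine ⟨N, fun n hn => ?_⟩
  rw [Real.dist_eq, sub_zero, abs_of_nonneg (ν.map_nonneg _),
    ← ν.eq_of_conj (pp u n) (a := rat u v (n + 1) * (rat u v n)⁻¹)
      (by simp only [rat, pp_succ]; group)]
  exact hN _ (by omega) _ hn

theorem isCau_rat_spread {C : Type*} [One C] {p : ℕ → ℕ} (hp : StrictMono p) (M : ℕ → C → A)
    (hM : ∀ i, M i 1 = 1) (x y : ℕ → C) :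
    ν.IsCau (rat (fun i => M i (spread p x i)) fun i => M i (spread p y i)) ↔
      ν.IsCau (rat (fun n => M (p n) (x n)) fun n => M (p n) (y n)) := by
  have key : ∀ i, rat (fun i => M i (spread p x i)) (fun i => M i (spread p y i)) i =
      rat (fun n => M (p n) (x n)) (fun n => M (p n) (y n)) (jdx p i) := fun i => by
    simp only [rat, pp_spread hp M hM]
  constructor
  · intro h
    convert h.comp hp.tendsto_atTop using 2 with n
    rw [key, jdx_apply hp]
  · intro h
    convert h.comp (tendsto_jdx hp) using 2 with i
    exact key i

end Basic

end InvLength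


/-! ### Lengths compatible with the topology, and completeness -/

namespace InvLength

variable {A : Type*} [Group A] [TopologicalSpace A]

/-- The length function induces the topology of `A`, and makes it complete. -/
structure IsCompat (ν : InvLength A) : Prop where
  nhds_one : 𝓝 (1 : A) = Filter.comap ν (𝓝 0)
  complete : ∀ r : ℕ → A, ν.IsCau r → ∃ a, Tendsto r atTop (𝓝 a)

variable [IsTopologicalGroup A] {ν : InvLength A}

theorem tendsto_iff_of_nhds (hν : 𝓝 (1 : A) = Filter.comap ν (𝓝 0)) {ι : Type*} {l : Filter ι}
    {u : ι → A} {a : A} :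
    Tendsto u l (𝓝 a) ↔ Tendsto (fun i => ν (u i * a⁻¹)) l (𝓝 0) := by
  have h1 : Tendsto u l (𝓝 a) ↔ Tendsto (fun i => u i * a⁻¹) l (𝓝 1) := by
    constructor
    · intro h
      simpa using h.mul_const a⁻¹
    · intro h
      simpa using h.mul_const a
  rw [h1, hν, tendsto_comap_iff]
  rfl

theorem mem_nhds_one_of_nhds (hν : 𝓝 (1 : A) = Filter.comap ν (𝓝 0)) {s : Set A} :
    s ∈ 𝓝 (1 : A) ↔ ∃ ε > 0, ∀ a, ν a < ε → a ∈ s := by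
  rw [hν, (Metric.nhds_basis_ball.comap ν).mem_iff]
  simp only [Set.subset_def, Set.mem_preimage, Metric.mem_ball, Real.dist_eq, sub_zero,
    abs_of_nonneg (ν.map_nonneg _)]

theorem mem_nhds_of_nhds (hν : 𝓝 (1 : A) = Filter.comap ν (𝓝 0)) {s : Set A} {a : A} :
    s ∈ 𝓝 a ↔ ∃ ε > 0, ∀ b, ν (b * a⁻¹) < ε → b ∈ s := by
  rw [← map_mul_right_nhds_one a, mem_map, mem_nhds_one_of_nhds hν]
  refine exists_congr fun ε => and_congr_right fun _ => ?_
  constructor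
  · intro h b hb
    simpa using h _ hb
  · intro h b hb
    exact h _ (by simpa using hb)

theorem tendsto_lt_iff_of_nhds (hν : 𝓝 (1 : A) = Filter.comap ν (𝓝 0)) {ι : Type*} {l : Filter ι}
    {u : ι → A} {a : A} :
    Tendsto u l (𝓝 a) ↔ ∀ ε > 0, ∀ᶠ i in l, ν (u i * a⁻¹) < ε := by
  rw [tendsto_iff_of_nhds hν, Metric.tendsto_nhds]
  simp only [Real.dist_eq, sub_zero, abs_of_nonneg (ν.map_nonneg _)]

/-- An invariant length on a Polish group is complete. -/
theorem exists_tendsto_of_isCau [PolishSpace A] (hν : 𝓝 (1 : A) = Filter.comap ν (𝓝 0))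
    {u : ℕ → A} (hu : ν.IsCau u) : ∃ a, Tendsto u atTop (𝓝 a) := by
  let := TopologicalSpace.upgradeIsCompletelyMetrizable A
  -- A point of `O ε` translates a tail of `u` into a `ν`-ball of diameter below `ε` for a complete
  -- metric. The gap `s < t` makes the condition open. A point in all these sets makes the translate
  -- of `u` Cauchy for the complete metric.
  let O : ℝ → Set A := fun ε => {g | ∃ s t : ℝ, ∃ N, s < t ∧ (∀ k ≥ N, ν (u k * (u N)⁻¹) ≤ s) ∧
    ∀ a b, ν (a * (u N * g)⁻¹) < t → ν (b * (u N * g)⁻¹) < t → dist a b < ε}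
  have hopen : ∀ ε, IsOpen (O ε) := by
    intro ε
    rw [isOpen_iff_mem_nhds]
    rintro g ⟨s, t, N, hst, hs, ht⟩
    refine (mem_nhds_of_nhds hν).2 ⟨(t - s) / 2, by linarith, fun g' hg' => ?_⟩
    refine ⟨s, (s + t) / 2, N, by linarith, hs, ?_⟩
    have key : ∀ a, ν (a * (u N * g')⁻¹) < (s + t) / 2 → ν (a * (u N * g)⁻¹) < t := by
      intro a ha
      have h1 := ν.triangle a (u N * g') (u N * g)
      rw [ν.eq_of_conj (u N) (a := u N * g' * (u N * g)⁻¹) (b := g' * g⁻¹) (by group)] at h1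
      linarith
    exact fun a b ha hb => ht a b (key a ha) (key b hb)
  have hdense : ∀ ε > 0, Dense (O ε) := by
    intro ε hε
    rw [dense_iff_inter_open]
    rintro V hV ⟨g, hg⟩
    obtain ⟨δ, hδ, hδV⟩ := (mem_nhds_of_nhds hν).1 (hV.mem_nhds hg)
    obtain ⟨N, hN⟩ := hu.two hδ
    obtain ⟨r, hr, hrb⟩ := (mem_nhds_of_nhds hν).1 (Metric.ball_mem_nhds (u N * g) (half_pos hε))
    obtain ⟨K, hK⟩ := hu.two (half_pos hr)
    set K' := max N K
    -- The point is chosen so that `u K'` sends it to `u N * g`, the centre of the small ball; it is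
    -- close to `g` because `u` is Cauchy.
    refine ⟨(u K')⁻¹ * (u N * g), hδV _ ?_, r / 2, r, K', by linarith, fun k hk => ?_, ?_⟩
    · rw [show (u K')⁻¹ * (u N * g) * g⁻¹ = (u K')⁻¹ * u N by group, ν.map_inv_mul]
      exact hN _ (le_max_left _ _) _ le_rfl
    · exact (hK k ((le_max_right _ _).trans hk) _ (le_max_right _ _)).le
    · intro a b ha hb
      rw [mul_inv_cancel_left] at ha hb
      have h1 := hrb a ha
      have h2 := hrb b hb
      rw [Metric.mem_ball] at h1 h2
      have := dist_triangle_right a b (u N * g)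
      linarith
  have hd : Dense (⋂ n : ℕ, O (1 / (n + 1))) :=
    dense_iInter_of_isOpen (fun n => hopen _) fun n => hdense _ Nat.one_div_pos_of_nat
  obtain ⟨g, hg⟩ := hd.nonempty
  rw [Set.mem_iInter] at hg
  have hc : CauchySeq fun k => u k * g := by
    rw [Metric.cauchySeq_iff]
    intro ε hε
    obtain ⟨n, hn⟩ := exists_nat_one_div_lt hε
    obtain ⟨s, t, N, hst, hs, ht⟩ := hg n
    have key : ∀ k ≥ N, ν (u k * g * (u N * g)⁻¹) < t := fun k hk => by
      rw [show u k * g * (u N * g)⁻¹ = u k * (u N)⁻¹ by group]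
      exact (hs k hk).trans_lt hst
    exact ⟨N, fun m hm k hk => (ht _ _ (key m hm) (key k hk)).trans hn⟩
  obtain ⟨h, hh⟩ := cauchySeq_tendsto_of_complete hc
  exact ⟨h * g⁻¹, by simpa using hh.mul_const g⁻¹⟩

theorem _root_.TSIPolish.IsTSI.exists_isCompat [PolishSpace A] (hA : IsTSI A) :
    ∃ ν : InvLength A, ν.IsCompat := by
  obtain ⟨d, hd, hl, hr⟩ := hA
  have h1 : ∀ a b, d.dist a b = d.dist (a * b⁻¹) 1 := fun a b => by
    rw [← hr b⁻¹ a b, mul_inv_cancel]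
  let ν : InvLength A :=
    { toFun := fun a => d.dist a 1
      map_one' := d.dist_self 1
      map_inv' := fun a => by rw [← hl a, mul_inv_cancel, mul_one]; exact d.dist_comm _ _
      map_mul_le' := fun a b => by
        have := d.dist_triangle (a * b) b 1
        rwa [h1 (a * b) b, mul_inv_cancel_right] at this
      map_conj' := fun a b => by rw [← h1, ← hl b a 1, mul_one] }
  have hν : 𝓝 (1 : A) = Filter.comap ν (𝓝 0) := by
    subst hd
    exact (nhds_comap_dist (1 : A)).symm
  exact ⟨ν, hν, fun r hr => exists_tendsto_of_isCau hν hr⟩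

namespace IsCompat

theorem tendsto_iff (hν : ν.IsCompat) {ι : Type*} {l : Filter ι} {u : ι → A} {a : A} :
    Tendsto u l (𝓝 a) ↔ ∀ ε > 0, ∀ᶠ i in l, ν (u i * a⁻¹) < ε :=
  tendsto_lt_iff_of_nhds hν.nhds_one

theorem mem_nhds (hν : ν.IsCompat) {s : Set A} {a : A} :
    s ∈ 𝓝 a ↔ ∃ ε > 0, ∀ b, ν (b * a⁻¹) < ε → b ∈ s := mem_nhds_of_nhds hν.nhds_one

theorem mem_nhds_one (hν : ν.IsCompat) {s : Set A} :
    s ∈ 𝓝 (1 : A) ↔ ∃ ε > 0, ∀ a, ν a < ε → a ∈ s := mem_nhds_one_of_nhds hν.nhds_one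

theorem isCau_iff (hν : ν.IsCompat) {r : ℕ → A} : ν.IsCau r ↔ ∃ a, Tendsto r atTop (𝓝 a) := by
  refine ⟨hν.complete r, ?_⟩
  rintro ⟨a, ha⟩ ε hε
  obtain ⟨N, hN⟩ := eventually_atTop.1 (hν.tendsto_iff.1 ha (ε / 2) (half_pos hε))
  refine ⟨N, fun n hn => ?_⟩
  have h1 := ν.triangle (r n) a (r N)
  have h2 := hN n hn
  have h3 := hN N le_rfl
  rw [ν.map_div_comm] at h3
  linarith

theorem eq_of_forall_lt [T1Space A] (hν : ν.IsCompat) {a b : A} (h : ∀ ε > 0, ν (a * b⁻¹) < ε) :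
    a = b := by
  by_contra hab
  obtain ⟨ε, hε, hs⟩ := hν.mem_nhds.1 (isOpen_compl_singleton.mem_nhds (Ne.symm hab))
  exact hs a (h ε hε) rfl

theorem continuous (hν : ν.IsCompat) : Continuous ν := by
  rw [continuous_iff_continuousAt]
  intro a
  rw [ContinuousAt, Metric.tendsto_nhds]
  intro ε hε
  filter_upwards [hν.tendsto_iff.1 (tendsto_id (x := 𝓝 a)) ε hε] with b hb
  rw [Real.dist_eq, abs_lt]
  have h1 := ν.map_le_add b a
  have h2 := ν.map_le_add a b
  rw [ν.map_div_comm] at h2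
  simp only [id] at hb
  constructor <;> linarith

theorem e_iff (hν : ν.IsCompat) (x y : ℕ → A) : E A x y ↔ ν.IsCau fun n => x n * (y n)⁻¹ :=
  hν.isCau_iff.symm

theorem eStar_iff (hν : ν.IsCompat) (x y : ℕ → A) : EStar A x y ↔ ν.IsCau (rat x y) := by
  rw [← isCau_succ_iff, hν.isCau_iff]
  change (∃ g : A, _) ↔ _
  simp only [partialProd_eq_pp, rat]

end IsCompat

end InvLength

theorem isTSI_pi {B : ℕ → Type*} [∀ m, Group (B m)] [t : ∀ m, TopologicalSpace (B m)]
    (hB : ∀ m, IsTSI (B m)) : IsTSI (∀ m, B m) := by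
  choose d hd hl hr using hB
  obtain rfl : (fun m => (d m).toUniformSpace.toTopologicalSpace) = t := funext hd
  let := d
  refine ⟨PiCountable.metricSpace, rfl, fun g h k => ?_, fun g h k => ?_⟩
  · exact tsum_congr fun m => congrArg _ (hl m _ _ _)
  · exact tsum_congr fun m => congrArg _ (hr m _ _ _)

theorem IsTSI.subgroup {B : Type*} [Group B] [t : TopologicalSpace B] (hB : IsTSI B)
    (H : Subgroup B) : IsTSI H := by
  obtain ⟨d, hd, hl, hr⟩ := hB
  subst hd
  exact ⟨inferInstance, rfl, fun g h k => hl g h k, fun g h k => hr g h k⟩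


/-! ### Baire category tools -/

section Generic

/-- The sequences that are eventually constant. -/
def evConst (D : Type*) : Set (ℕ → D) := {s | ∃ N, ∀ i ≥ N, s i = s N}

theorem countable_evConst (D : Type*) [Countable D] : (evConst D).Countable := by
  have h : evConst D = ⋃ N, {s | ∀ i ≥ N, s i = s N} := by
    ext s; simp [evConst]
  rw [h]
  refine Set.countable_iUnion fun N => ?_
  refine Set.countable_of_injective_of_countable_image
    (f := fun (s : ℕ → D) (i : Fin (N + 1)) => s i) ?_ (Set.to_countable _)
  intro s hs t ht hst
  have key : ∀ i ≤ N, s i = t i := fun i hi => congrFun hst ⟨i, by omega⟩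
  funext i
  rcases le_total i N with hi | hi
  · exact key i hi
  · rw [hs i hi, ht i hi, key N le_rfl]

theorem mul_inv_mem_evConst {D : Type*} [Group D] {s t : ℕ → D} (hs : s ∈ evConst D)
    (ht : t ∈ evConst D) : s * t⁻¹ ∈ evConst D := by
  obtain ⟨N, hN⟩ := hs
  obtain ⟨K, hK⟩ := ht
  refine ⟨max N K, fun i hi => ?_⟩
  simp only [Pi.mul_apply, Pi.inv_apply]
  rw [hN i (by omega), hK i (by omega), hN (max N K) (by omega), hK (max N K) (by omega)]

theorem exists_open_residual {X ι : Type*} [TopologicalSpace X] [MeasurableSpace X] [BorelSpace X]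
    [Countable ι] (A : ι → Set X) (hA : ∀ i, MeasurableSet (A i)) :
    ∃ U : ι → Set X, (∀ i, IsOpen (U i)) ∧ ∀ᶠ x in residual X, ∀ i, x ∈ A i ↔ x ∈ U i := by
  choose U hU hAU using fun i => (hA i).residualEq_isOpen
  exact ⟨U, hU, eventually_countable_forall.2 fun i => (hAU i).mem_iff⟩

theorem exists_dense_open_seq {X : Type*} [TopologicalSpace X] {p : X → Prop}
    (h : ∀ᶠ x in residual X, p x) :
    ∃ O : ℕ → Set X, (∀ n, IsOpen (O n)) ∧ (∀ n, Dense (O n)) ∧ ∀ x, (∀ n, x ∈ O n) → p x := by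
  obtain ⟨S, ho, hd, hc, hS⟩ := mem_residual_iff.1 h
  obtain ⟨O, hO⟩ := (hc.insert Set.univ).exists_eq_range (Set.insert_nonempty _ _)
  have hmem : ∀ n, O n = Set.univ ∨ O n ∈ S := fun n => by
    rw [← Set.mem_insert_iff, hO]; exact ⟨n, rfl⟩
  refine ⟨O, fun n => ?_, fun n => ?_, fun x hx => hS ?_⟩
  · rcases hmem n with h' | h'
    · rw [h']; exact isOpen_univ
    · exact ho _ h'
  · rcases hmem n with h' | h'
    · rw [h']; exact dense_univ
    · exact hd _ h'
  · rw [Set.mem_sInter]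
    intro t ht
    obtain ⟨n, rfl⟩ : t ∈ Set.range O := hO ▸ Set.mem_insert_of_mem _ ht
    exact hx n

end Generic

/-! ### Finite conditions that control a Borel map -/

section Stage

variable {D K : Type*} [Group D] [Group K] (ν : InvLength K) (f : (ℕ → D) → ℕ → K)
  (O : ℕ → Set (ℕ → D))

/-- The point `z`, restricted to its first `p` entries, decides the behaviour of `f` on
the translates by elements of `S` up to `l`, and the tails after `l`, with error `(1 / 2) ^ n`. -/
structure Decides (n : ℕ) (S : Set (ℕ → D)) (z : ℕ → D) (p l : ℕ) : Prop where
  mem : ∀ z', (∀ i < p, z' i = z i) → ∀ γ ∈ S, γ * z' ∈ O n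
  tail : ∀ z', (∀ i < p, z' i = z i) → ∀ γ ∈ S, ∀ γ' ∈ S, (∀ m, γ * z' ∈ O m) → ∀ k ≥ l,
    ν (f (γ' * z') k * (f (γ * z') k)⁻¹ * (f (γ' * z') l * (f (γ * z') l)⁻¹)⁻¹) ≤ (1 / 2) ^ n
  head : ∀ z' z'', (∀ i < p, z' i = z i) → (∀ i < p, z'' i = z i) → ∀ γ ∈ S,
    (∀ m, γ * z' ∈ O m) → (∀ m, γ * z'' ∈ O m) → ∀ k ≤ l,
    ν (f (γ * z') k * (f (γ * z'') k)⁻¹) ≤ 2 * (1 / 2) ^ n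

end Stage

theorem exists_cylinder_subset {D : Type*} [TopologicalSpace D] [DiscreteTopology D]
    {z : ℕ → D} {T : Set (ℕ → D)} (hT : T ∈ 𝓝 z) :
    ∃ p, ∀ z', (∀ i < p, z' i = z i) → z' ∈ T := by
  obtain ⟨_, ⟨x, n, rfl⟩, hz, hx⟩ :=
    (PiNat.isTopologicalBasis_cylinders fun _ => D).mem_nhds_iff.1 hT
  refine ⟨n, fun z' hz' => hx ?_⟩
  rw [PiNat.mem_cylinder_iff] at hz ⊢
  exact fun i hi => (hz' i hi).trans (hz i hi)

/-- Borel sets agree with open sets on a comeager set. Apply this to the countably many statements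
"the tail after `l` is small" and "the `k`-th value is near a given point of a dense sequence". A
generic extension of `z` has generic translates by the finite set `S`; what holds for them is an
open condition, so finitely many entries force it at generic points. -/
theorem exists_decides {D K : Type*} [Group D] [Countable D] [TopologicalSpace D]
    [DiscreteTopology D] [MeasurableSpace (ℕ → D)] [BorelSpace (ℕ → D)]
    [Group K] [TopologicalSpace K] [IsTopologicalGroup K] [PolishSpace K] [MeasurableSpace K]
    [BorelSpace K] {ν : InvLength K} (hν : ν.IsCompat) (f : (ℕ → D) → ℕ → K)
    (hf : ∀ k, Measurable fun v => f v k)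
    (hE : ∀ s ∈ evConst D, ∀ v, ν.IsCau fun k => f (s * v) k * (f v k)⁻¹) :
    ∃ O : ℕ → Set (ℕ → D), ∀ (n : ℕ) (z : ℕ → D) (p l : ℕ) (S : Set (ℕ → D)),
      ∃ (z₁ : ℕ → D) (p₁ l₁ : ℕ), (∀ i < p, z₁ i = z i) ∧ p < p₁ ∧ l < l₁ ∧
        (S.Finite → S ⊆ evConst D → Decides ν f O n S z₁ p₁ l₁) := by
  have : Countable (evConst D) := (countable_evConst D).to_subtype
  have hmul : ∀ s : ℕ → D, Continuous fun v : ℕ → D => s * v := fun s => continuous_const_mul s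
  let A : evConst D × ℕ × ℕ → Set (ℕ → D) := fun i => {v | ∀ k ≥ i.2.1,
    ν (f (i.1.1 * v) k * (f v k)⁻¹ * (f (i.1.1 * v) i.2.1 * (f v i.2.1)⁻¹)⁻¹) ≤ (1 / 2) ^ i.2.2}
  have hA : ∀ i, MeasurableSet (A i) := by
    rintro ⟨s, l, n⟩
    have h1 : ∀ k, Measurable fun v => f (s.1 * v) k := fun k => (hf k).comp (hmul s.1).measurable
    have : A (s, l, n) = ⋂ k, ⋂ (_ : k ≥ l), {v | ν (f (s.1 * v) k * (f v k)⁻¹ *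
        (f (s.1 * v) l * (f v l)⁻¹)⁻¹) ≤ (1 / 2) ^ n} := by
      ext v; simp [A]
    rw [this]
    refine MeasurableSet.iInter fun k => MeasurableSet.iInter fun _ => ?_
    exact measurableSet_le (hν.continuous.measurable.comp
      (((h1 k).mul (hf k).inv).mul ((h1 l).mul (hf l).inv).inv)) measurable_const
  obtain ⟨b, hb⟩ := TopologicalSpace.exists_dense_seq K
  let B : ℕ × ℕ × ℕ → Set (ℕ → D) := fun i => {v | ν (f v i.1 * (b i.2.1)⁻¹) < (1 / 2) ^ i.2.2}
  have hB : ∀ i, MeasurableSet (B i) := by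
    rintro ⟨k, j, n⟩
    exact measurableSet_lt (hν.continuous.measurable.comp ((hf k).mul measurable_const))
      measurable_const
  obtain ⟨U, hU, hAU⟩ := exists_open_residual A hA
  obtain ⟨V, hV, hBV⟩ := exists_open_residual B hB
  obtain ⟨O, hO, hOd, hAB⟩ := exists_dense_open_seq (hAU.and hBV)
  refine ⟨O, fun n z p l S => ?_⟩
  -- If `S` is unsuitable, any strictly longer stage will do; the choice is thus total and can be
  -- iterated.
  by_cases hS : S.Finite ∧ S ⊆ evConst D
  swap
  · exact ⟨z, p + 1, l + 1, fun _ _ => rfl, by omega, by omega, fun h h' => absurd ⟨h, h'⟩ hS⟩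
  obtain ⟨hSf, hSe⟩ := hS
  -- a point all of whose translates by `S` are generic
  obtain ⟨z₀, hz₀, hgen⟩ : ∃ z₀ : ℕ → D, (∀ i < p, z₀ i = z i) ∧ ∀ γ ∈ S, ∀ m, γ * z₀ ∈ O m := by
    have hc : S.Countable := hSf.countable
    have hd : Dense (⋂ γ ∈ S, ⋂ m, (fun v => γ * v) ⁻¹' O m) := by
      refine dense_of_mem_residual ((countable_bInter_mem hc).2 fun γ _ =>
        countable_iInter_mem.2 fun m => ?_)
      exact residual_of_dense_open ((hO m).preimage (hmul γ))
        ((hOd m).preimage (Homeomorph.mulLeft γ).isOpenMap)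
    obtain ⟨z₀, h1, h2⟩ := hd.inter_open_nonempty _ (PiNat.isOpen_cylinder (fun _ => D) z p)
      ⟨z, PiNat.self_mem_cylinder z p⟩
    exact ⟨z₀, fun i hi => PiNat.mem_cylinder_iff.1 h1 i hi, by simpa using h2⟩
  have hpow : (0 : ℝ) < (1 / 2) ^ n := by positivity
  -- the bound for the tails
  have hl : ∀ q : (ℕ → D) × (ℕ → D), ∃ N, q.1 ∈ S → q.2 ∈ S → ∀ k ≥ N, ∀ k' ≥ N,
      ν (f (q.2 * z₀) k * (f (q.1 * z₀) k)⁻¹ *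
        (f (q.2 * z₀) k' * (f (q.1 * z₀) k')⁻¹)⁻¹) < (1 / 2) ^ n := by
    rintro ⟨γ, γ'⟩
    by_cases h : γ ∈ S ∧ γ' ∈ S
    · obtain ⟨N, hN⟩ := (hE _ (mul_inv_mem_evConst (hSe h.2) (hSe h.1)) (γ * z₀)).two hpow
      rw [show γ' * γ⁻¹ * (γ * z₀) = γ' * z₀ by group] at hN
      exact ⟨N, fun _ _ => hN⟩
    · exact ⟨0, fun h1 h2 => absurd ⟨h1, h2⟩ h⟩
  choose N hN using hl
  obtain ⟨l₁, hl₁, hNl⟩ : ∃ l₁, l < l₁ ∧ ∀ γ ∈ S, ∀ γ' ∈ S, N (γ, γ') ≤ l₁ := by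
    obtain ⟨L, hL⟩ := ((hSf.prod hSf).image N).bddAbove
    refine ⟨max L (l + 1), by omega, fun γ hγ γ' hγ' => ?_⟩
    exact (hL ⟨(γ, γ'), ⟨hγ, hγ'⟩, rfl⟩).trans (le_max_left _ _)
  -- approximate values
  have hj : ∀ γ : ℕ → D, ∀ k, ∃ j, ν (f (γ * z₀) k * (b j)⁻¹) < (1 / 2) ^ n := by
    intro γ k
    have hmem : {a | ν (a * (f (γ * z₀) k)⁻¹) < (1 / 2) ^ n} ∈ 𝓝 (f (γ * z₀) k) :=
      hν.mem_nhds.2 ⟨_, hpow, fun _ h => h⟩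
    obtain ⟨a, ha, j, rfl⟩ := mem_closure_iff_nhds.1 (hb (f (γ * z₀) k)) _ hmem
    exact ⟨j, by rw [ν.map_div_comm]; exact ha⟩
  choose j hj using hj
  have hnhds : (∀ᶠ z' in 𝓝 z₀, ∀ γ ∈ S, γ * z' ∈ O n) ∧
      (∀ᶠ z' in 𝓝 z₀, ∀ γ ∈ S, ∀ γ' ∈ S, ∀ h : γ' * γ⁻¹ ∈ evConst D,
        γ * z' ∈ U (⟨γ' * γ⁻¹, h⟩, l₁, n)) ∧
      ∀ᶠ z' in 𝓝 z₀, ∀ γ ∈ S, ∀ k ∈ Set.Iic l₁, γ * z' ∈ V (k, j γ k, n) := by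
    refine ⟨(hSf.eventually_all).2 fun γ hγ => ?_, (hSf.eventually_all).2 fun γ hγ =>
      (hSf.eventually_all).2 fun γ' hγ' => eventually_all.2 fun h => ?_,
      (hSf.eventually_all).2 fun γ hγ => ((Set.finite_Iic l₁).eventually_all).2 fun k _ => ?_⟩
    · exact ((hO n).preimage (hmul γ)).mem_nhds (hgen γ hγ n)
    · refine ((hU _).preimage (hmul γ)).mem_nhds (((hAB _ (hgen γ hγ)).1 _).1 ?_)
      intro k hk
      have := hN (γ, γ') hγ hγ' k ((hNl γ hγ γ' hγ').trans hk) l₁ (hNl γ hγ γ' hγ')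
      simp only
      rw [show γ' * γ⁻¹ * (γ * z₀) = γ' * z₀ by group]
      exact this.le
    · exact ((hV _).preimage (hmul γ)).mem_nhds (((hAB _ (hgen γ hγ)).2 _).1 (hj γ k))
  obtain ⟨h1, h2, h3⟩ := hnhds
  obtain ⟨p₁, hp₁⟩ := exists_cylinder_subset (h1.and (h2.and h3))
  have hp : ∀ z' : ℕ → D, (∀ i < max p₁ (p + 1), z' i = z₀ i) → ∀ i < p₁, z' i = z₀ i :=
    fun z' h i hi => h i (by omega)
  refine ⟨z₀, max p₁ (p + 1), l₁, hz₀, by omega, hl₁, fun _ _ => ⟨?_, ?_, ?_⟩⟩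
  · exact fun z' hz' γ hγ => (hp₁ z' (hp z' hz')).1 γ hγ
  · intro z' hz' γ hγ γ' hγ' hm k hk
    have h4 := (hp₁ z' (hp z' hz')).2.1 γ hγ γ' hγ' (mul_inv_mem_evConst (hSe hγ') (hSe hγ))
    have h5 := ((hAB _ hm).1 _).2 h4 k hk
    simp only at h5
    rwa [show γ' * γ⁻¹ * (γ * z') = γ' * z' by group] at h5
  · intro z' z'' hz' hz'' γ hγ hm' hm'' k hk
    have h4 := ((hAB _ hm').2 _).2 ((hp₁ z' (hp z' hz')).2.2 γ hγ k hk)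
    have h5 := ((hAB _ hm'').2 _).2 ((hp₁ z'' (hp z'' hz'')).2.2 γ hγ k hk)
    have h6 := ν.triangle (f (γ * z') k) (b (j γ k)) (f (γ * z'') k)
    rw [ν.map_div_comm (b (j γ k))] at h6
    simp only [B, Set.mem_ofPred_eq] at h4 h5
    linarith


/-! ### Step functions with prescribed partial products -/

section Stretch

variable {D : Type*} [Group D]

/-- The partial products of `spread p x`. -/
noncomputable def stretch (p : ℕ → ℕ) (x : ℕ → D) : ℕ → D := fun i => pp x (jdx p (i + 1))

/-- The first `n` entries of `x`, followed by `1`. -/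
def trunc (n : ℕ) (x : ℕ → D) : ℕ → D := fun i => if i < n then x i else 1

theorem trunc_of_lt {n i : ℕ} (x : ℕ → D) (h : i < n) : trunc n x i = x i := if_pos h

theorem trunc_of_le {n i : ℕ} (x : ℕ → D) (h : n ≤ i) : trunc n x i = 1 := if_neg (not_lt.2 h)

theorem stretch_trunc_of_lt {p : ℕ → ℕ} (hp : StrictMono p) (x : ℕ → D) {n i : ℕ} (h : i < p n) :
    stretch p (trunc n x) i = stretch p x i := by
  refine pp_congr fun m hm => trunc_of_lt x ?_
  rw [lt_jdx hp] at hm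
  exact hp.lt_iff_lt.1 (by omega)

theorem stretch_trunc_of_le {p : ℕ → ℕ} (hp : StrictMono p) (x : ℕ → D) {n i : ℕ}
    (h : ∀ m < n, p m ≤ i) : stretch p (trunc n x) i = pp x n := by
  have hn : n ≤ jdx p (i + 1) := by
    by_contra hcon
    have h1 := h _ (not_le.1 hcon)
    exact lt_irrefl _ ((lt_jdx hp).2 (Nat.lt_succ_of_le h1))
  rw [stretch, pp_of_one hn fun m hm _ => trunc_of_le x hm]
  exact pp_congr fun m hm => trunc_of_lt x hm

/-- Equal factors cancel in the ratio, so it is constant from `n` on. -/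
theorem rat_trunc {x y : ℕ → D} {n : ℕ} (h : ∀ i ≥ n, x i = y i) (c : ℕ) :
    rat (trunc n x) (trunc n y) c = rat x y c := by
  have key : ∀ c ≤ n, rat (trunc n x) (trunc n y) c = rat x y c := fun c hc => by
    rw [rat, rat, pp_congr fun i hi => trunc_of_lt x (lt_of_lt_of_le hi hc),
      pp_congr fun i hi => trunc_of_lt y (lt_of_lt_of_le hi hc)]
  rcases le_total c n with hc | hc
  · exact key c hc
  · induction c, hc using Nat.le_induction with
    | base => exact key n le_rfl
    | succ c hc ih =>
      have h1 : ∀ u v : ℕ → D, u c = v c → rat u v (c + 1) = rat u v c := fun u v huv => by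
        simp only [rat, pp_succ, huv]; group
      rw [h1 _ _ (h c hc), h1 _ _ (by rw [trunc_of_le x hc, trunc_of_le y hc]), ih]

/-- The sequence `γ`, multiplied by `g` from position `p` on. -/
def tailMul (p : ℕ) (γ : ℕ → D) (g : D) : ℕ → D := fun i => if i < p then γ i else γ i * g

theorem tailMul_mem_evConst {p : ℕ} {γ : ℕ → D} {g : D} (h : γ ∈ evConst D) :
    tailMul p γ g ∈ evConst D := by
  obtain ⟨N, hN⟩ := h
  refine ⟨max N p, fun i hi => ?_⟩
  simp only [tailMul]
  rw [if_neg (by omega), if_neg (by omega), hN i (by omega), hN (max N p) (by omega)]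

theorem stretch_trunc_succ {p : ℕ → ℕ} (hp : StrictMono p) (x : ℕ → D) (n : ℕ) :
    stretch p (trunc (n + 1) x) = tailMul (p n) (stretch p (trunc n x)) (x n) := by
  funext i
  rw [tailMul]
  split_ifs with h
  · rw [stretch_trunc_of_lt hp x h, stretch_trunc_of_lt hp x (h.trans (hp n.lt_succ_self))]
  · rw [stretch_trunc_of_le hp x fun m hm => (hp.monotone (Nat.lt_succ_iff.1 hm)).trans
      (not_lt.1 h), stretch_trunc_of_le hp x fun m hm => (hp.monotone hm.le).trans (not_lt.1 h),
      pp_succ]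

end Stretch

/-- At stage `n` only finitely many step functions are possible, since the sets `F n` are finite;
`exists_decides` handles all of them at once. Two sequences with a common tail give translates of
one point by two of these functions, so the tail clause applies. Two with a common beginning give
translates of two points by one function, so the head clause applies. -/
theorem exists_filler {D K : Type*} [Group D] [Countable D] [TopologicalSpace D]
    [DiscreteTopology D] [MeasurableSpace (ℕ → D)] [BorelSpace (ℕ → D)]
    [Group K] [TopologicalSpace K] [IsTopologicalGroup K] [PolishSpace K] [MeasurableSpace K]
    [BorelSpace K] {ν : InvLength K} (hν : ν.IsCompat) (f : (ℕ → D) → ℕ → K)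
    (hf : ∀ k, Measurable fun v => f v k)
    (hE : ∀ s ∈ evConst D, ∀ v, ν.IsCau fun k => f (s * v) k * (f v k)⁻¹)
    (F : ℕ → Set D) (hF : ∀ n, (F n).Finite) :
    ∃ (z : ℕ → D) (p l : ℕ → ℕ), StrictMono p ∧ StrictMono l ∧ l 0 = 0 ∧
      ∀ x y : ℕ → D, (∀ n, x n ∈ F n) → (∀ n, y n ∈ F n) → ∀ n,
        ((∀ i ≥ n, x i = y i) → ∀ k ≥ l n,
          ν (f (stretch p x * z) k * (f (stretch p y * z) k)⁻¹ *
            (f (stretch p x * z) (l n) * (f (stretch p y * z) (l n))⁻¹)⁻¹) ≤ 2 * (1 / 2) ^ n) ∧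
        ((∀ i < n + 1, x i = y i) → ∀ k ≤ l (n + 1),
          ν (f (stretch p x * z) k * (f (stretch p y * z) k)⁻¹) ≤ 2 * (1 / 2) ^ n) := by
  obtain ⟨O, hO⟩ := exists_decides hν f hf hE
  choose zz pn ln hz hp hl hdec using hO
  let next : ℕ → (ℕ → D) × ℕ × ℕ × Set (ℕ → D) → (ℕ → D) × ℕ × ℕ × Set (ℕ → D) := fun n s =>
    -- `S'` consists of the step functions with one more admissible entry, inserted at the current
    -- position.
    let S' := Set.image2 (tailMul s.2.1) s.2.2.2 (F n)
    (zz n s.1 s.2.1 s.2.2.1 S', pn n s.1 s.2.1 s.2.2.1 S', ln n s.1 s.2.1 s.2.2.1 S', S')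
  let st : ℕ → (ℕ → D) × ℕ × ℕ × Set (ℕ → D) := fun n => Nat.rec (1, 0, 0, {1}) next n
  let Z : ℕ → ℕ → D := fun n => (st n).1
  let p : ℕ → ℕ := fun n => (st n).2.1
  let l : ℕ → ℕ := fun n => (st n).2.2.1
  let S : ℕ → Set (ℕ → D) := fun n => (st n).2.2.2
  have hS_succ : ∀ n, S (n + 1) = Set.image2 (tailMul (p n)) (S n) (F n) := fun n => rfl
  have hZ_succ : ∀ n, ∀ i < p n, Z (n + 1) i = Z n i := fun n => hz n _ _ _ _
  have hpm : StrictMono p := strictMono_nat_of_lt_succ fun n => hp n _ _ _ _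
  have hlm : StrictMono l := strictMono_nat_of_lt_succ fun n => hl n _ _ _ _
  have hS : ∀ n, (S n).Finite ∧ S n ⊆ evConst D := by
    intro n
    induction n with
    | zero =>
      refine ⟨Set.finite_singleton _, Set.singleton_subset_iff.2 ⟨0, fun _ _ => rfl⟩⟩
    | succ n ih =>
      rw [hS_succ]
      refine ⟨ih.1.image2 _ (hF n), ?_⟩
      rintro _ ⟨γ, hγ, g, -, rfl⟩
      exact tailMul_mem_evConst (ih.2 hγ)
  have hD : ∀ n, Decides ν f O n (S (n + 1)) (Z (n + 1)) (p (n + 1)) (l (n + 1)) := fun n =>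
    hdec n _ _ _ _ (hS (n + 1)).1 (hS (n + 1)).2
  have hmem : ∀ x : ℕ → D, (∀ n, x n ∈ F n) → ∀ n, stretch p (trunc n x) ∈ S n := by
    intro x hx n
    induction n with
    | zero =>
      change _ = _
      funext i
      exact stretch_trunc_of_le hpm x fun m hm => absurd hm (Nat.not_lt_zero m)
    | succ n ih =>
      rw [stretch_trunc_succ hpm, hS_succ]
      exact ⟨_, ih, _, hx n, rfl⟩
  let z : ℕ → D := fun i => Z (i + 1) i
  have hZ_le : ∀ n m, n ≤ m → ∀ i < p n, Z m i = Z n i := by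
    intro n m hnm
    induction m, hnm using Nat.le_induction with
    | base => exact fun _ _ => rfl
    | succ m hm ih =>
      exact fun i hi => (hZ_succ m i (hi.trans_le (hpm.monotone hm))).trans (ih i hi)
  have hz : ∀ n, ∀ i < p n, z i = Z n i := by
    intro n i hi
    rcases le_total n (i + 1) with h | h
    · exact hZ_le n (i + 1) h i hi
    · exact (hZ_le (i + 1) n h i (lt_of_lt_of_le i.lt_succ_self (hpm.id_le _))).symm
  -- the point to which the translate by a truncation has to be applied
  let w : ℕ → (ℕ → D) → ℕ → D := fun n x => (stretch p (trunc n x))⁻¹ * (stretch p x * z)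
  have hw : ∀ n x, stretch p (trunc n x) * w n x = stretch p x * z := fun n x =>
    mul_inv_cancel_left _ _
  have hwz : ∀ n x, ∀ i < p n, w n x i = Z n i := by
    intro n x i hi
    rw [← hz n i hi]
    change (stretch p (trunc n x) i)⁻¹ * (stretch p x i * z i) = z i
    rw [stretch_trunc_of_lt hpm x hi, inv_mul_cancel_left]
  -- Stage `m` secures only membership in `O m`; genericity comes from all stages together.
  have hgen : ∀ x : ℕ → D, (∀ n, x n ∈ F n) → ∀ m, stretch p x * z ∈ O m := by
    intro x hx m
    rw [← hw (m + 1) x]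
    exact (hD m).mem _ (hwz (m + 1) x) _ (hmem x hx (m + 1))
  refine ⟨z, p, l, hpm, hlm, rfl, fun x y hx hy n => ⟨fun hxy k hk => ?_, fun hxy k hk => ?_⟩⟩
  -- At `n = 0` nothing has been decided, but then the sequences coincide. The shift by one stage
  -- accounts for the factor 2 in the bound.
  · rcases n with - | n
    · obtain rfl : x = y := funext fun i => hxy i (Nat.zero_le i)
      simp
    -- A common tail freezes the ratio of partial products, so the same `w` serves both sequences.
    · have h1 : stretch p (trunc (n + 1) x) * w (n + 1) y = stretch p x * z := by
        funext i
        have h2 : rat (trunc (n + 1) x) (trunc (n + 1) y) (jdx p (i + 1)) =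
          rat x y (jdx p (i + 1)) := rat_trunc hxy _
        change stretch p (trunc (n + 1) x) i *
          ((stretch p (trunc (n + 1) y) i)⁻¹ * (stretch p y i * z i)) = stretch p x i * z i
        rw [← mul_assoc]
        change rat (trunc (n + 1) x) (trunc (n + 1) y) (jdx p (i + 1)) * _ = _
        rw [h2, rat, stretch, stretch]
        group
      have h3 := (hD n).tail _ (hwz (n + 1) y) _ (hmem y hy (n + 1)) _ (hmem x hx (n + 1))
        (by rw [hw]; exact hgen y hy) k hk
      rw [h1, hw] at h3
      refine h3.trans (le_of_eq ?_)
      rw [pow_succ]; ring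
  · have h1 : trunc (n + 1) x = trunc (n + 1) y := by
      funext i
      by_cases hi : i < n + 1
      · rw [trunc_of_lt x hi, trunc_of_lt y hi, hxy i hi]
      · rw [trunc_of_le x (not_lt.1 hi), trunc_of_le y (not_lt.1 hi)]
    have h2 := hw (n + 1) x
    have h3 := hwz (n + 1) x
    have h4 := (hD n).head _ _ h3 (hwz (n + 1) y) _ (hmem y hy (n + 1))
      (by rw [← h1, h2]; exact hgen x hx) (by rw [hw]; exact hgen y hy) k hk
    rwa [hw, ← h1, h2] at h4


/-! ### Block decomposition of the reduction -/

theorem pp_inv_mul_succ {K : Type*} [Group K] (r : ℕ → K) (n : ℕ) :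
    pp (fun i => (r i)⁻¹ * r (i + 1)) n = (r 0)⁻¹ * r n := by
  induction n with
  | zero => simp
  | succ n ih => rw [pp_succ, ih]; group

theorem InvLength.isCau_of_blocks {K : Type*} [Group K] (ν : InvLength K) {r : ℕ → K} {l : ℕ → ℕ}
    (hl : StrictMono l) {e : ℕ → ℝ} (he : Tendsto e atTop (𝓝 0))
    (hr : ∀ n k, l n ≤ k → k ≤ l (n + 1) → ν (r k * (r (l n))⁻¹) ≤ e n)
    (h : ν.IsCau fun n => r (l n)) : ν.IsCau r := by
  intro ε hε
  obtain ⟨N, hN⟩ := h.two (half_pos hε)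
  obtain ⟨N₁, hN₁⟩ := Metric.tendsto_atTop.1 he (ε / 2) (half_pos hε)
  refine ⟨l (max N N₁), fun k hk => ?_⟩
  have h0 : max N N₁ < jdx l (k + 1) := (lt_jdx hl).2 (Nat.lt_succ_of_le hk)
  obtain ⟨n, hn⟩ : ∃ n, n + 1 = jdx l (k + 1) := ⟨jdx l (k + 1) - 1, by omega⟩
  have hn1 : l n ≤ k := Nat.lt_succ_iff.1 ((lt_jdx hl (i := k + 1)).1 (by omega))
  have hn2 : k ≤ l (n + 1) := by
    by_contra hcon
    have := (lt_jdx hl (n := n + 1) (i := k + 1)).2 (by omega)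
    omega
  have h1 := hr n k hn1 hn2
  have h3 := hN n (by omega) (max N N₁) (by omega)
  have h4 := hN₁ n (by omega)
  rw [Real.dist_eq, sub_zero] at h4
  have h6 := ν.triangle (r k) (r (l n)) (r (l (max N N₁)))
  linarith [le_abs_self (e n)]

/-- The product of the block increments telescopes to the values at the block ends `l n`.
Convergence there is captured by `M`, and `Δ` records the oscillation between the ends, which is
what remains for convergence of the whole sequence. -/
theorem exists_blocks {D K : Type*} [Group D] [Countable D] [TopologicalSpace D]
    [DiscreteTopology D] [MeasurableSpace (ℕ → D)] [BorelSpace (ℕ → D)]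
    [Group K] [TopologicalSpace K] [IsTopologicalGroup K] [PolishSpace K] [MeasurableSpace K]
    [BorelSpace K] {ν : InvLength K} (hν : ν.IsCompat) (f : (ℕ → D) → ℕ → K)
    (hf : ∀ k, Measurable fun v => f v k)
    (hE : ∀ s ∈ evConst D, ∀ v, ν.IsCau fun k => f (s * v) k * (f v k)⁻¹)
    (F : ℕ → Set D) (hF : ∀ n, (F n).Finite) (hF1 : ∀ n, 1 ∈ F n) :
    ∃ (z : ℕ → D) (p : ℕ → ℕ) (M : ℕ → D → K) (Δ : ℕ → D → D → ℝ), StrictMono p ∧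
      (∀ n, M n 1 = 1) ∧ (∀ n g h, 0 ≤ Δ n g h) ∧
      ∀ x y : ℕ → D, (∀ n, x n ∈ F n) → (∀ n, y n ∈ F n) →
        ((ν.IsCau fun k => f (stretch p x * z) k * (f (stretch p y * z) k)⁻¹) ↔
          ν.IsCau (rat (fun n => M n (x n)) fun n => M n (y n)) ∧
            Tendsto (fun n => Δ n (x n) (y n)) atTop (𝓝 0)) := by
  obtain ⟨z, p, l, hp, hl, -, hfil⟩ := exists_filler hν f hf hE F hF
  -- Dividing by the image of the trivial sequence gives `M n 1 = 1` and leaves the ratios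
  -- unchanged.
  let φ : (ℕ → D) → ℕ → K := fun x k =>
    f (stretch p x * z) k * (f (stretch p (fun _ => 1) * z) k)⁻¹
  have hφ : ∀ x y k, φ x k * (φ y k)⁻¹ = f (stretch p x * z) k * (f (stretch p y * z) k)⁻¹ :=
    fun x y k => by simp only [φ]; group
  have hφ1 : ∀ k, φ (fun _ => 1) k = 1 := fun k => mul_inv_cancel _
  let a : ℕ → (ℕ → D) → ℕ → K := fun n x k => (φ x (l n))⁻¹ * φ x k
  let e : ℕ → D → ℕ → D := fun n g i => if i = n then g else 1
  let J : ℕ → D → ℕ → K := fun n g k => a n (e n g) k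
  let M : ℕ → D → K := fun n g => J n g (l (n + 1))
  have hll : ∀ n, l n ≤ l (n + 1) := fun n => (hl n.lt_succ_self).le
  let Δ : ℕ → D → D → ℝ := fun n g h => (Finset.Icc (l n) (l (n + 1))).sup'
    (Finset.nonempty_Icc.2 (hll n)) fun k => ν (J n g k * (J n h k)⁻¹)
  have hΔ : ∀ n g h k, l n ≤ k → k ≤ l (n + 1) → ν (J n g k * (J n h k)⁻¹) ≤ Δ n g h :=
    fun n g h k h1 h2 => Finset.le_sup' (fun k => ν (J n g k * (J n h k)⁻¹))
      (Finset.mem_Icc.2 ⟨h1, h2⟩)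
  have hΔ0 : ∀ n g h, 0 ≤ Δ n g h := fun n g h =>
    (ν.map_nonneg _).trans (hΔ n g h (l n) le_rfl (hll n))
  have hM1 : ∀ n, M n 1 = 1 := by
    intro n
    have : e n 1 = fun _ => 1 := funext fun i => ite_self _
    simp only [M, J, a, this, hφ1, inv_one, mul_one]
  -- the increments of `φ x` in a block depend, up to a summable error, only on one entry of `x`
  have hJ : ∀ x : ℕ → D, (∀ n, x n ∈ F n) → ∀ n k, l n ≤ k → k ≤ l (n + 1) →
      ν (a n x k * (J n (x n) k)⁻¹) ≤ 6 * (1 / 2) ^ n := by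
    intro x hx n k h1 h2
    have hy : ∀ i, trunc (n + 1) x i ∈ F i := fun i => by
      unfold trunc; split_ifs; exacts [hx i, hF1 i]
    have hw : ∀ i, e n (x n) i ∈ F i := fun i => by
      by_cases h : i = n
      · simpa only [e, h, if_true] using hx n
      · simpa only [e, h, if_false] using hF1 i
    -- The constant 6 is 2 + 2 + 2: cutting `x` after entry `n` costs 2 at each of the two positions
    -- in the increment, and deleting the entries before `n` costs 2 more.
    have hB := (hfil x (trunc (n + 1) x) hx hy n).2 fun i hi => (trunc_of_lt x hi).symm
    have hA := (hfil (trunc (n + 1) x) (e n (x n)) hy hw n).1 (fun i hi => by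
      rcases eq_or_lt_of_le hi with rfl | hi
      · rw [trunc_of_lt x (Nat.lt_succ_self _)]; simp [e]
      · rw [trunc_of_le x hi]; simp [e, hi.ne']) k h1
    have h3 := hB k h2
    have h4 := hB (l n) (hll n)
    simp only [← hφ] at hA h3 h4
    have h5 := ν.map_mul_mul_le (φ x (l n))⁻¹ (φ x k) (φ (trunc (n + 1) x) (l n))⁻¹
      (φ (trunc (n + 1) x) k)
    rw [inv_inv, ν.map_inv_mul] at h5
    have h6 : ν (a n (trunc (n + 1) x) k * (J n (x n) k)⁻¹) ≤ 2 * (1 / 2) ^ n := by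
      refine le_trans (le_of_eq ?_) hA
      refine ν.eq_of_conj (φ (trunc (n + 1) x) (l n))⁻¹ ?_
      simp only [a, J]; group
    have h7 := ν.triangle (a n x k) (a n (trunc (n + 1) x) k) (J n (x n) k)
    simp only [a] at h5 h6 h7 ⊢
    linarith
  have hsum : Summable fun n : ℕ => (6 : ℝ) * (1 / 2) ^ n :=
    summable_geometric_two.mul_left 6
  have hconv : Tendsto (fun n : ℕ => (12 : ℝ) * (1 / 2) ^ n) atTop (𝓝 0) := by
    simpa using (summable_geometric_two.mul_left 12).tendsto_atTop_zero
  refine ⟨z, p, M, Δ, hp, hM1, hΔ0, fun x y hx hy => ?_⟩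
  let r : ℕ → K := fun k => φ x k * (φ y k)⁻¹
  have hr : (fun k => f (stretch p x * z) k * (f (stretch p y * z) k)⁻¹) = r :=
    funext fun k => (hφ x y k).symm
  rw [hr]
  have ha : ∀ n k, ν (a n x k * (a n y k)⁻¹) = ν (r k * (r (l n))⁻¹) := fun n k => by
    refine ν.eq_of_conj (φ x (l n))⁻¹ ?_
    simp only [a, r]; group
  have hux : ∀ n, pp (fun n => a n x (l (n + 1))) n = (φ x (l 0))⁻¹ * φ x (l n) :=
    pp_inv_mul_succ fun n => φ x (l n)
  have huy : ∀ n, pp (fun n => a n y (l (n + 1))) n = (φ y (l 0))⁻¹ * φ y (l n) :=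
    pp_inv_mul_succ fun n => φ y (l n)
  have hrat : (ν.IsCau fun n => r (l n)) ↔
      ν.IsCau (rat (fun n => M n (x n)) fun n => M n (y n)) := by
    have h1 : (ν.IsCau fun n => r (l n)) ↔
        ν.IsCau (rat (fun n => a n x (l (n + 1))) fun n => a n y (l (n + 1))) := by
      constructor
      · intro h
        convert ((ν.isCau_const (φ x (l 0))⁻¹).mul h).mul (ν.isCau_const (φ y (l 0))) using 2 with n
        rw [rat, hux, huy]; simp only [r]; group
      · intro h
        convert ((ν.isCau_const (φ x (l 0))).mul h).mul (ν.isCau_const (φ y (l 0))⁻¹) using 2 with n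
        rw [rat, hux, huy]; simp only [r]; group
    rw [h1]
    have hx' := fun n => hJ x hx n (l (n + 1)) (hll n) le_rfl
    have hy' := fun n => hJ y hy n (l (n + 1)) (hll n) le_rfl
    refine ⟨ν.isCau_rat_congr hsum hx' hy', ν.isCau_rat_congr hsum (fun n => ?_) fun n => ?_⟩
    · rw [ν.map_div_comm]; exact hx' n
    · rw [ν.map_div_comm]; exact hy' n
  have hcmp : ∀ n k, l n ≤ k → k ≤ l (n + 1) →
      ν (J n (x n) k * (J n (y n) k)⁻¹) ≤ ν (r k * (r (l n))⁻¹) + 12 * (1 / 2) ^ n ∧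
      ν (r k * (r (l n))⁻¹) ≤ ν (J n (x n) k * (J n (y n) k)⁻¹) + 12 * (1 / 2) ^ n := by
    intro n k h1 h2
    have hx' := hJ x hx n k h1 h2
    have hy' := hJ y hy n k h1 h2
    have t1 := ν.triangle (J n (x n) k) (a n x k) (J n (y n) k)
    have t2 := ν.triangle (a n x k) (a n y k) (J n (y n) k)
    have t3 := ν.triangle (a n x k) (J n (x n) k) (a n y k)
    have t4 := ν.triangle (J n (x n) k) (J n (y n) k) (a n y k)
    rw [ν.map_div_comm (J n (x n) k) (a n x k)] at t1
    rw [ν.map_div_comm (J n (y n) k) (a n y k)] at t4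
    rw [ha] at t2 t3
    constructor <;> linarith
  rw [← hrat]
  constructor
  · intro h
    refine ⟨h.comp hl.tendsto_atTop, ?_⟩
    rw [Metric.tendsto_atTop]
    intro ε hε
    obtain ⟨N, hN⟩ := h.two (half_pos hε)
    obtain ⟨N', hN'⟩ := Metric.tendsto_atTop.1 hconv (ε / 2) (half_pos hε)
    refine ⟨max N N', fun n hn => ?_⟩
    rw [Real.dist_eq, sub_zero, abs_of_nonneg (hΔ0 _ _ _), Finset.sup'_lt_iff]
    intro k hk
    rw [Finset.mem_Icc] at hk
    have h1 := (hcmp n k hk.1 hk.2).1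
    have hNl : N ≤ l n := (le_max_left N N').trans (hn.trans (hl.id_le n))
    have h2 := hN k (hNl.trans hk.1) (l n) hNl
    have h3 := hN' n ((le_max_right _ _).trans hn)
    rw [Real.dist_eq, sub_zero] at h3
    linarith [le_abs_self ((12 : ℝ) * (1 / 2) ^ n)]
  · rintro ⟨h, hd⟩
    refine ν.isCau_of_blocks hl (e := fun n => Δ n (x n) (y n) + 12 * (1 / 2) ^ n)
      (by simpa using hd.add hconv) (fun n k h1 h2 => ?_) h
    have h3 := (hcmp n k h1 h2).2
    have h4 := hΔ n (x n) (y n) k h1 h2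
    linarith


/-! ### Asymptotic homomorphisms and strong NSS -/

section Aux

theorem pp_trunc {D : Type*} [Group D] (n : ℕ) (x : ℕ → D) (m : ℕ) :
    pp (trunc n x) m = pp x (min m n) := by
  rcases le_total m n with h | h
  · rw [min_eq_left h]
    exact pp_congr fun i hi => trunc_of_lt x (hi.trans_le h)
  · rw [min_eq_right h, pp_of_one h fun i hi _ => trunc_of_le x hi]
    exact pp_congr fun i hi => trunc_of_lt x hi

theorem pp_three_mul {D : Type*} [Group D] (w : ℕ → D) (k : ℕ) :
    pp w (3 * k) = pp (fun i => w (3 * i) * w (3 * i + 1) * w (3 * i + 2)) k := by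
  induction k with
  | zero => rfl
  | succ k ih =>
    rw [show 3 * (k + 1) = 3 * k + 1 + 1 + 1 by ring, pp_succ, pp_succ, pp_succ, ih, pp_succ]
    simp only [mul_assoc]

theorem prod_ofFn_eq_pp {K : Type*} [Group K] (w : ℕ → K) (k : ℕ) :
    (List.ofFn fun i : Fin k => w i).prod = pp w k := by
  induction k with
  | zero => rfl
  | succ k ih =>
    rw [List.ofFn_succ', List.concat_eq_append, List.prod_append, pp_succ, ← ih]
    simp

theorem IsStronglyNSS.exists_bound {K : Type*} [Group K] [TopologicalSpace K]
    [IsTopologicalGroup K] (hK : IsStronglyNSS K) {ν : InvLength K} (hν : ν.IsCompat) :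
    ∃ η > 0, ∀ c : ℕ → K, ¬ Tendsto c atTop (𝓝 1) →
      ∃ n : ℕ → ℕ, StrictMono n ∧ ∃ k, η ≤ ν (pp (fun i => c (n i)) k) := by
  obtain ⟨V, hVo, hV1, hV⟩ := hK
  obtain ⟨η, hη, hηV⟩ := hν.mem_nhds_one.1 (hVo.mem_nhds hV1)
  refine ⟨η, hη, fun c hc => ?_⟩
  obtain ⟨k, n, hn, hnV⟩ := hV c hc
  -- The finite choice of indices is extended to an infinite increasing one; the values after `k`
  -- play no role.
  let n' : ℕ → ℕ := fun i => if h : i < k + 1 then n ⟨i, h⟩ else n (Fin.last k) + i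
  refine ⟨n', ?_, k + 1, ?_⟩
  · refine strictMono_nat_of_lt_succ fun i => ?_
    simp only [n']
    split_ifs with h1 h2 h2
    · exact hn (by simp)
    · have : (⟨i, h1⟩ : Fin (k + 1)) ≤ Fin.last k := Fin.le_last _
      have := hn.monotone this
      omega
    · omega
    · omega
  · rw [← prod_ofFn_eq_pp]
    by_contra hcon
    have hc : (fun i : Fin (k + 1) => c (n i)) = fun i : Fin (k + 1) => c (n' i) := by
      funext i
      simp only [n', dif_pos i.2]
    refine hnV (hηV _ ?_)
    rw [hc]
    exact not_le.1 hcon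

end Aux

/-- A sequence of maps, admissible arguments and homomorphism property. -/
structure AsympHom {D K : Type*} [Group D] [Group K] (L : InvLength D) (ν : InvLength K)
    (adm : ℕ → D → Prop) (M : ℕ → D → K) : Prop where
  adm_one : ∀ n, adm n 1
  adm_eventually : ∀ g, ∀ᶠ n in atTop, adm n g
  map_one : ∀ n, M n 1 = 1
  hom : ∀ x y : ℕ → D, (∀ n, adm n (x n)) → (∀ n, adm n (y n)) → L.IsCau (rat x y) →
    ν.IsCau (rat (fun n => M n (x n)) fun n => M n (y n))

namespace AsympHom

variable {D K : Type*} [Group D] [Group K] {L : InvLength D} {ν : InvLength K}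
  {adm : ℕ → D → Prop} {M : ℕ → D → K}

theorem pp_concat {A B : Type*} [Group B] {N : ℕ → ℕ} (hN : StrictMono N) (X : ℕ → ℕ → A)
    (M : ℕ → A → B) (hX : ∀ j n, n < N j → M n (X j n) = 1) (j n : ℕ) (h1 : N j ≤ n)
    (h2 : n ≤ N (j + 1)) :
    pp (fun n => M n (X (jdx N (n + 1) - 1) n)) n =
      pp (fun n => M n (X (jdx N (n + 1) - 1) n)) (N j) * pp (fun n => M n (X j n)) n := by
  induction n, h1 using Nat.le_induction with
  | base =>
    rw [pp_of_one (Nat.zero_le (N j)) fun i _ hi => hX j i hi, pp_zero, mul_one]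
  | succ n hn ih =>
    have hj : jdx N (n + 1) - 1 = j := by
      have h3 : j < jdx N (n + 1) := (lt_jdx hN).2 (by omega)
      have h4 : ¬ j + 1 < jdx N (n + 1) := by rw [lt_jdx hN]; omega
      omega
    rw [pp_succ, ih (by omega), pp_succ, mul_assoc, hj]

/-- Otherwise, finitely supported counterexamples with `δ = (1 / 2) ^ j` can be concatenated in
disjoint blocks. The resulting ratio is Cauchy in the source, while each block still contributes an
oscillation of at least `ε` in the target. -/
theorem uniform (h : AsympHom L ν adm M) {ε : ℝ} (hε : 0 < ε) :
    ∃ δ > 0, ∃ N, ∀ x y : ℕ → D, (∀ n, adm n (x n)) → (∀ n, adm n (y n)) →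
      (∀ n < N, x n = 1 ∧ y n = 1) → (∃ b, ∀ n ≥ b, x n = 1 ∧ y n = 1) →
      (∀ n, L (rat x y n) ≤ δ) → ∀ n, ν (rat (fun n => M n (x n)) (fun n => M n (y n)) n) < ε := by
  by_contra hcon
  push Not at hcon
  have hpow : ∀ j : ℕ, (0 : ℝ) < (1 / 2) ^ j := fun j => by positivity
  choose x y hx hy hsupp hb hL n hn using fun j : ℕ => hcon ((1 / 2) ^ j) (hpow j)
  choose b hb using hb
  -- `N (j + 1)` lies past the support of the pair chosen for `N j`. As `N 0 = 0`, every index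
  -- belongs to a block, and the subtraction in `ind` is harmless.
  let N : ℕ → ℕ := fun j => Nat.rec 0 (fun j N => max (b j N) (N + 1)) j
  have hN_succ : ∀ j, N (j + 1) = max (b j (N j)) (N j + 1) := fun _ => rfl
  have hN : StrictMono N := strictMono_nat_of_lt_succ fun j => by rw [hN_succ]; omega
  let X : ℕ → ℕ → D := fun j => x j (N j)
  let Y : ℕ → ℕ → D := fun j => y j (N j)
  let ind : ℕ → ℕ := fun n => jdx N (n + 1) - 1
  let x' : ℕ → D := fun n => X (ind n) n
  let y' : ℕ → D := fun n => Y (ind n) n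
  have hXL : ∀ j n, N j ≤ n → n ≤ N (j + 1) → pp x' n = pp x' (N j) * pp (X j) n :=
    pp_concat hN X (fun _ g => g) fun j n hn => (hsupp j (N j) n hn).1
  have hYL : ∀ j n, N j ≤ n → n ≤ N (j + 1) → pp y' n = pp y' (N j) * pp (Y j) n :=
    pp_concat hN Y (fun _ g => g) fun j n hn => (hsupp j (N j) n hn).2
  have hXM : ∀ j n, N j ≤ n → n ≤ N (j + 1) → pp (fun n => M n (x' n)) n =
      pp (fun n => M n (x' n)) (N j) * pp (fun n => M n (X j n)) n :=
    pp_concat hN X M fun j n hn => by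
      rw [show X j n = 1 from (hsupp j (N j) n hn).1, h.map_one]
  have hYM : ∀ j n, N j ≤ n → n ≤ N (j + 1) → pp (fun n => M n (y' n)) n =
      pp (fun n => M n (y' n)) (N j) * pp (fun n => M n (Y j n)) n :=
    pp_concat hN Y M fun j n hn => by
      rw [show Y j n = 1 from (hsupp j (N j) n hn).2, h.map_one]
  have hratL : ∀ j n, N j ≤ n → n ≤ N (j + 1) →
      L (rat x' y' n * (rat x' y' (N j))⁻¹) ≤ (1 / 2) ^ j := by
    intro j n h1 h2
    refine le_trans (le_of_eq ?_) (hL j (N j) n)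
    refine L.eq_of_conj (pp x' (N j)) ?_
    change _ = pp x' (N j) * rat (X j) (Y j) n * (pp x' (N j))⁻¹
    rw [rat, rat, hXL j n h1 h2, hYL j n h1 h2, rat]
    group
  have hcau : L.IsCau (rat x' y') := by
    refine L.isCau_of_blocks hN (e := fun j => (1 / 2) ^ j)
      summable_geometric_two.tendsto_atTop_zero hratL ?_
    exact L.isCau_of_summable summable_geometric_two fun j =>
      hratL j _ (hN j.lt_succ_self).le le_rfl
  obtain ⟨N₀, hN₀⟩ := (h.hom x' y' (fun n => hx _ _ n) (fun n => hy _ _ n) hcau).two hε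
  -- a contradiction in the block with index `N₀`
  set j := N₀ with hj
  have hjN : N₀ ≤ N j := hN.id_le _
  have hlt : N j < N (j + 1) := hN j.lt_succ_self
  have key : ∀ m, N j ≤ m → m ≤ N (j + 1) →
      ν (rat (fun n => M n (X j n)) (fun n => M n (Y j n)) m) < ε := by
    intro m h1 h2
    refine lt_of_eq_of_lt ?_ (hN₀ m (hjN.trans h1) (N j) hjN)
    symm
    refine ν.eq_of_conj (pp (fun n => M n (x' n)) (N j)) ?_
    rw [rat, rat, hXM j m h1 h2, hYM j m h1 h2, rat]
    group
  refine absurd (hn j (N j)) (not_le.2 ?_)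
  change ν (rat (fun n => M n (X j n)) (fun n => M n (Y j n)) (n j (N j))) < ε
  rcases lt_or_ge (n j (N j)) (N j) with h1 | h1
  · have h2 : pp (fun n => M n (X j n)) (n j (N j)) = 1 :=
      pp_of_one (Nat.zero_le _) fun i _ hi => by
        rw [show X j i = 1 from (hsupp j (N j) i (hi.trans h1)).1, h.map_one]
    have h3 : pp (fun n => M n (Y j n)) (n j (N j)) = 1 :=
      pp_of_one (Nat.zero_le _) fun i _ hi => by
        rw [show Y j i = 1 from (hsupp j (N j) i (hi.trans h1)).2, h.map_one]
    rw [rat, h2, h3]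
    simpa using hε
  · rcases le_total (n j (N j)) (N (j + 1)) with h2 | h2
    · exact key _ h1 h2
    · have h3 : ∀ i, N (j + 1) ≤ i → X j i = 1 ∧ Y j i = 1 := fun i hi =>
        hb j (N j) i ((le_max_left _ _).trans hi)
      rw [rat, pp_of_one h2 fun i hi _ => ?_, pp_of_one h2 fun i hi _ => ?_]
      · exact key _ hlt.le le_rfl
      · rw [(h3 i hi).2, h.map_one]
      · rw [(h3 i hi).1, h.map_one]

/-- The products of values at three increasing places tend to the identity. -/
def Tends3 (ν : InvLength K) (M : ℕ → D → K) (u v w : D) : Prop :=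
  ∀ ε > 0, ∃ N, ∀ a b c, N ≤ a → a < b → b < c → ν (M a u * M b v * M c w) < ε

/-- The periodic sequence `u, v, w, u, v, w, …`. -/
def per (u v w : D) (n : ℕ) : D := if n % 3 = 0 then u else if n % 3 = 1 then v else w

theorem pp_per {u v w : D} (h : u * v * w = 1) (n : ℕ) :
    pp (per u v w) (3 * n) = 1 ∧ pp (per u v w) (3 * n + 1) = u ∧
      pp (per u v w) (3 * n + 2) = u * v := by
  have h0 : pp (per u v w) (3 * n) = 1 := by
    rw [pp_three_mul]
    have : (fun i => per u v w (3 * i) * per u v w (3 * i + 1) * per u v w (3 * i + 2)) =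
        fun _ => 1 := by
      funext i
      simp [per, Nat.add_mod, h]
    rw [this, pp_one]
  have h1 : pp (per u v w) (3 * n + 1) = u := by
    rw [pp_succ, h0, one_mul]; simp [per]
  refine ⟨h0, h1, ?_⟩
  rw [pp_succ, h1]; simp [per, Nat.add_mod]

/-- Since `u * v * w = 1`, the partial products of the periodic sequence take only the values `1`,
`u`, `u * v`. Arbitrarily many repetitions therefore never drift apart. -/
theorem rat_per_le {u v w u' v' w' : D} (h : u * v * w = 1) (h' : u' * v' * w' = 1) {δ : ℝ}
    (hδ : 0 < δ) (h1 : L (u * u'⁻¹) ≤ δ) (h2 : L (u * v * (u' * v')⁻¹) ≤ δ) (m : ℕ) :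
    L (rat (per u v w) (per u' v' w') m) ≤ δ := by
  obtain ⟨a1, a2, a3⟩ := pp_per h (m / 3)
  obtain ⟨b1, b2, b3⟩ := pp_per h' (m / 3)
  obtain hm | hm | hm : m = 3 * (m / 3) ∨ m = 3 * (m / 3) + 1 ∨ m = 3 * (m / 3) + 2 := by omega
  · rw [hm, rat, a1, b1]; simpa using hδ.le
  · rw [hm, rat, a2, b2]; exact h1
  · rw [hm, rat, a3, b3]; exact h2

theorem pp_le (ν : InvLength K) (w : ℕ → K) {e : ℝ} (h : ∀ i, ν (w i) ≤ e * (1 / 2) ^ (i + 1))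
    (k : ℕ) : ν (pp w k) ≤ e * (1 - (1 / 2) ^ k) := by
  induction k with
  | zero => simp
  | succ k ih =>
    have := ν.map_mul_le (pp w k) (w k)
    have := h k
    rw [pp_succ]
    have h2 : e * (1 - (1 / 2) ^ (k + 1)) = e * (1 - (1 / 2) ^ k) + e * (1 / 2) ^ (k + 1) := by
      rw [pow_succ]; ring
    linarith

/-- If the property failed for `u, v, w`, there would be disjoint triples of positions with products
of length at least `ε`, and NSS would select some whose total product has length at least `η`. At
these positions the products for `u', v', w'` have total length below `η / 2`, and by `uniform` the
two totals differ by less than `η / 2`. -/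
theorem exists_tends3 (h : AsympHom L ν adm M) {η : ℝ} (hη : 0 < η)
    (hNSS : ∀ c : ℕ → K, (∃ ε > 0, ∀ i, ε ≤ ν (c i)) →
      ∃ n : ℕ → ℕ, StrictMono n ∧ ∃ k, η ≤ ν (pp (fun i => c (n i)) k)) :
    ∃ δ > 0, ∀ u v w u' v' w' : D, u * v * w = 1 → u' * v' * w' = 1 → L (u * u'⁻¹) ≤ δ →
      L (u * v * (u' * v')⁻¹) ≤ δ → Tends3 ν M u' v' w' → Tends3 ν M u v w := by
  obtain ⟨δ, hδ, N₀, hU⟩ := h.uniform (half_pos hη)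
  refine ⟨δ, hδ, fun u v w u' v' w' huvw huvw' h1 h2 h3 => ?_⟩
  by_contra hcon
  simp only [Tends3] at hcon
  push Not at hcon
  obtain ⟨ε, hε, hcon⟩ := hcon
  have hadm : ∀ g : D, ∃ N, ∀ n ≥ N, adm n g := fun g => eventually_atTop.1 (h.adm_eventually g)
  choose A hA using hadm
  have hpow : ∀ i : ℕ, 0 < η / 2 * (1 / 2) ^ (i + 1) := fun i => by positivity
  choose B hB using fun i => h3 _ (hpow i)
  have hex : ∀ N i : ℕ, ∃ a b c, N ≤ a ∧ N₀ ≤ a ∧ (∀ g ∈ [u, v, w, u', v', w'], A g ≤ a) ∧ a < b ∧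
      b < c ∧ ε ≤ ν (M a u * M b v * M c w) ∧
      ν (M a u' * M b v' * M c w') < η / 2 * (1 / 2) ^ (i + 1) := by
    intro N i
    obtain ⟨a, b, c, ha, hab, hbc, hC⟩ := hcon (N + N₀ + B i + A u + A v + A w + A u' + A v' + A w')
    refine ⟨a, b, c, by omega, by omega, ?_, hab, hbc, hC, hB i a b c (by omega) hab hbc⟩
    simp only [List.mem_cons, List.not_mem_nil, or_false, forall_eq_or_imp, forall_eq]
    omega
  choose a b c haN haN₀ hAa hab hbc hC hBi using hex
  let s : ℕ → ℕ := fun j => Nat.rec 0 (fun j N => c N j + 1) j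
  have hs_succ : ∀ j, s (j + 1) = c (s j) j + 1 := fun _ => rfl
  let q₀ : ℕ → ℕ := fun j => a (s j) j
  let q₁ : ℕ → ℕ := fun j => b (s j) j
  let q₂ : ℕ → ℕ := fun j => c (s j) j
  have hq01 : ∀ j, q₀ j < q₁ j := fun j => hab _ _
  have hq12 : ∀ j, q₁ j < q₂ j := fun j => hbc _ _
  have hs : StrictMono s := strictMono_nat_of_lt_succ fun j => by
    rw [hs_succ]
    have h4 := haN (s j) j
    have h5 := hq01 j
    have h6 := hq12 j
    simp only [q₀, q₁, q₂] at h5 h6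
    omega
  have hq20 : ∀ i j, i < j → q₂ i < q₀ j := fun i j hij =>
    lt_of_lt_of_le (lt_of_lt_of_le (Nat.lt_succ_self _) (hs.monotone hij)) (haN (s j) j)
  obtain ⟨n, hn, k, hk⟩ := hNSS (fun j => M (q₀ j) u * M (q₁ j) v * M (q₂ j) w)
    ⟨ε, hε, fun i => hC _ _⟩
  -- Enumerates the three positions of each selected triple in turn.
  let p : ℕ → ℕ := fun m => if m % 3 = 0 then q₀ (n (m / 3)) else
    if m % 3 = 1 then q₁ (n (m / 3)) else q₂ (n (m / 3))
  have hp : StrictMono p := by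
    refine strictMono_nat_of_lt_succ fun m => ?_
    have h01 := hq01 (n (m / 3))
    have h12 := hq12 (n (m / 3))
    obtain hm | hm | hm : m % 3 = 0 ∨ m % 3 = 1 ∨ m % 3 = 2 := by omega
    · have : (m + 1) % 3 = 1 := by omega
      have h7 : (m + 1) / 3 = m / 3 := by omega
      simpa [p, hm, this, h7] using h01
    · have : (m + 1) % 3 = 2 := by omega
      have h7 : (m + 1) / 3 = m / 3 := by omega
      simpa [p, hm, this, h7] using h12
    · have : (m + 1) % 3 = 0 := by omega
      have h7 : (m + 1) / 3 = m / 3 + 1 := by omega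
      simpa [p, hm, this, h7] using hq20 _ _ (hn (Nat.lt_succ_self (m / 3)))
  have hp0 : ∀ m, p 0 ≤ p m := fun m => hp.monotone (Nat.zero_le m)
  have hp00 : p 0 = q₀ (n 0) := by simp [p]
  let X : D → D → D → ℕ → D := fun u v w => spread p (trunc (3 * k) (per u v w))
  have hXadm : ∀ u v w, A u ≤ p 0 → A v ≤ p 0 → A w ≤ p 0 → ∀ i, adm i (X u v w i) := by
    intro u v w hu hv hw i
    by_cases hi : i ∈ Set.range p
    · obtain ⟨m, rfl⟩ := hi
      simp only [X]
      rw [spread_apply hp]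
      simp only [trunc, per]
      split_ifs
      · exact hA _ _ (hu.trans (hp0 m))
      · exact hA _ _ (hv.trans (hp0 m))
      · exact hA _ _ (hw.trans (hp0 m))
      · exact h.adm_one _
    · simp only [X]
      rw [spread_of_not_mem _ hi]
      exact h.adm_one _
  have hXlow : ∀ u v w, ∀ i < N₀, X u v w i = 1 := by
    intro u v w i hi
    refine spread_of_not_mem _ ?_
    rintro ⟨m, rfl⟩
    have := hp0 m
    have := haN₀ (s (n 0)) (n 0)
    simp only [hp00, q₀] at *
    omega
  have hXhigh : ∀ u v w, ∀ i ≥ p (3 * k), X u v w i = 1 := by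
    intro u v w i hi
    by_cases hi' : i ∈ Set.range p
    · obtain ⟨m, rfl⟩ := hi'
      simp only [X]
      rw [spread_apply hp, trunc_of_le _ (hp.le_iff_le.1 hi)]
    · exact spread_of_not_mem _ hi'
  have hXpp : ∀ u v w, pp (fun i => M i (X u v w i)) (p (3 * k)) =
      pp (fun i => M (q₀ (n i)) u * M (q₁ (n i)) v * M (q₂ (n i)) w) k := by
    intro u v w
    rw [pp_spread hp M h.map_one, jdx_apply hp, pp_three_mul]
    refine pp_congr fun i hi => ?_
    rw [trunc_of_lt _ (by omega), trunc_of_lt _ (by omega), trunc_of_lt _ (by omega)]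
    have e1 : (3 * i + 1) / 3 = i := by omega
    have e2 : (3 * i + 2) / 3 = i := by omega
    simp [p, per, Nat.add_mod, e1, e2]
  have hAp := hAa (s (n 0)) (n 0)
  rw [show a (s (n 0)) (n 0) = p 0 from hp00.symm] at hAp
  simp only [List.mem_cons, List.not_mem_nil, or_false, forall_eq_or_imp, forall_eq] at hAp
  obtain ⟨A1, A2, A3, A4, A5, A6⟩ := hAp
  have hfin := hU (X u v w) (X u' v' w') (hXadm _ _ _ A1 A2 A3) (hXadm _ _ _ A4 A5 A6)
    (fun i hi => ⟨hXlow _ _ _ i hi, hXlow _ _ _ i hi⟩)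
    ⟨p (3 * k), fun i hi => ⟨hXhigh _ _ _ i hi, hXhigh _ _ _ i hi⟩⟩ (fun i => ?_) (p (3 * k))
  · rw [rat, hXpp, hXpp] at hfin
    have h8 := pp_le ν (fun i => M (q₀ (n i)) u' * M (q₁ (n i)) v' * M (q₂ (n i)) w') (e := η / 2)
      (fun i => (hBi _ _).le.trans (mul_le_mul_of_nonneg_left (pow_le_pow_of_le_one (by norm_num)
        (by norm_num) (Nat.succ_le_succ (hn.id_le i))) (half_pos hη).le)) k
    have h9 := ν.map_le_add (pp (fun i => M (q₀ (n i)) u * M (q₁ (n i)) v * M (q₂ (n i)) w) k)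
      (pp (fun i => M (q₀ (n i)) u' * M (q₁ (n i)) v' * M (q₂ (n i)) w') k)
    have h10 : 0 < η / 2 * (1 / 2) ^ k := by positivity
    linarith
  · have e : ∀ x : ℕ → D, pp (spread p x) i = pp x (jdx p i) :=
      fun x => pp_spread hp (fun _ g => g) (fun _ => rfl) x i
    simp only [X]
    rw [rat, e, e, pp_trunc, pp_trunc]
    exact rat_per_le huvw huvw' hδ h1 h2 _

end AsympHom


/-! ### Limits of the maps at points of G -/

/-- Pairs `(n, d)` with `d` admissible at `n`, `n` large and `d` close to `g`. -/
def nearFilter {D G : Type*} [Group D] [Group G] [TopologicalSpace G] (ι : D →* G)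
    (adm : ℕ → D → Prop) (g : G) : Filter (ℕ × D) :=
  (atTop ×ˢ comap ι (𝓝 g)) ⊓ 𝓟 {q | adm q.1 q.2}

section

variable {D G K : Type*} [Group D] [Group G] [TopologicalSpace G] [IsTopologicalGroup G]
  [Group K] {ι : D →* G} {adm : ℕ → D → Prop} {νG : InvLength G}

theorem exists_approx (hνG : νG.IsCompat) (hι : DenseRange ι) (g : G) {ε : ℝ} (hε : 0 < ε) :
    ∃ d, νG (ι d * g⁻¹) < ε := by
  obtain ⟨_, ha, d, rfl⟩ := mem_closure_iff_nhds.1 (hι g) _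
    (hνG.mem_nhds.2 ⟨ε, hε, fun b hb => hb⟩)
  exact ⟨d, ha⟩

theorem eventually_nearFilter (hνG : νG.IsCompat) {g : G} {P : ℕ × D → Prop} :
    (∀ᶠ q in nearFilter ι adm g, P q) ↔
      ∃ δ > 0, ∃ N, ∀ n ≥ N, ∀ d, adm n d → νG (ι d * g⁻¹) < δ → P (n, d) := by
  rw [nearFilter, eventually_inf_principal, eventually_prod_iff]
  constructor
  · rintro ⟨pa, ha, pb, hb, h⟩
    obtain ⟨N, hN⟩ := eventually_atTop.1 ha
    rw [eventually_comap] at hb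
    obtain ⟨δ, hδ, hb⟩ := hνG.mem_nhds.1 hb
    exact ⟨δ, hδ, N, fun n hn d hd hdg => h (hN n hn) (hb _ hdg d rfl) hd⟩
  · rintro ⟨δ, hδ, N, h⟩
    refine ⟨fun n => N ≤ n, eventually_ge_atTop N, fun d => νG (ι d * g⁻¹) < δ, ?_,
      fun hn d hd ha => h _ hn _ ha hd⟩
    rw [eventually_comap]
    refine hνG.mem_nhds.2 ⟨δ, hδ, ?_⟩
    rintro _ hb d rfl
    exact hb

theorem nearFilter_neBot (hνG : νG.IsCompat) (hι : DenseRange ι)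
    (hadm : ∀ d, ∀ᶠ n in atTop, adm n d) (g : G) : (nearFilter ι adm g).NeBot := by
  rw [← frequently_true_iff_neBot]
  intro h
  obtain ⟨δ, hδ, N, h⟩ := (eventually_nearFilter hνG).1 h
  obtain ⟨d, hd⟩ := exists_approx hνG hι g hδ
  obtain ⟨n, hn⟩ := ((hadm d).and (eventually_ge_atTop N)).exists
  exact h n hn.2 d hn.1 hd trivial

/-- A property that holds near `g` holds at some `d` close to `g`, for all large `n`. -/
theorem exists_of_eventually_nearFilter (hνG : νG.IsCompat) (hι : DenseRange ι)
    (hadm : ∀ d, ∀ᶠ n in atTop, adm n d) {g : G} {P : ℕ × D → Prop}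
    (h : ∀ᶠ q in nearFilter ι adm g, P q) {ε : ℝ} (hε : 0 < ε) :
    ∃ d, νG (ι d * g⁻¹) < ε ∧ ∀ᶠ n in atTop, adm n d ∧ P (n, d) := by
  obtain ⟨δ, hδ, N, h⟩ := (eventually_nearFilter hνG).1 h
  obtain ⟨d, hd⟩ := exists_approx hνG hι g (lt_min hδ hε)
  refine ⟨d, hd.trans_le (min_le_right _ _), ?_⟩
  filter_upwards [hadm d, eventually_ge_atTop N] with n h1 h2
  exact ⟨h1, h n h2 d h1 (hd.trans_le (min_le_left _ _))⟩

end

namespace AsympHom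

variable {D G K : Type*} [Group D] [Group G] [TopologicalSpace G] [IsTopologicalGroup G]
  [Group K] {ι : D →* G} {adm : ℕ → D → Prop} {νG : InvLength G}
  {ν : InvLength K} {M : ℕ → D → K}

theorem uniform_single {L : InvLength D} (h : AsympHom L ν adm M) {ε : ℝ} (hε : 0 < ε) :
    ∃ δ > 0, ∃ N, ∀ n ≥ N, ∀ g g', adm n g → adm n g' → L (g * g'⁻¹) ≤ δ →
      ν (M n g * (M n g')⁻¹) < ε := by
  obtain ⟨δ, hδ, N, hU⟩ := h.uniform hε
  refine ⟨δ, hδ, N, fun n hn g g' hg hg' hgg' => ?_⟩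
  let e : D → ℕ → D := fun g i => if i = n then g else 1
  have hne : ∀ g, ∀ i, i ≠ n → e g i = 1 := fun g i hi => if_neg hi
  have heq : ∀ g, e g n = g := fun g => if_pos rfl
  have hadm : ∀ g, adm n g → ∀ i, adm i (e g i) := fun g hg i => by
    by_cases hi : i = n
    · subst hi; rwa [heq]
    · rw [hne g i hi]; exact h.adm_one i
  have hpp : ∀ g i, pp (e g) i = if n < i then g else 1 := by
    intro g i
    have h0 : pp (e g) n = 1 := pp_of_one (Nat.zero_le n) fun i _ hi => hne g i hi.ne
    split_ifs with hi
    · rw [pp_of_one hi fun j hj _ => hne g j (by omega), pp_succ, h0, one_mul, heq]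
    · exact pp_of_one (Nat.zero_le i) fun j _ hj => hne g j (by omega)
  have hM : ∀ g, pp (fun i => M i (e g i)) (n + 1) = M n g := by
    intro g
    rw [pp_succ, pp_of_one (Nat.zero_le n) fun i _ hi => by rw [hne g i hi.ne, h.map_one], heq]
    simp
  have := hU (e g) (e g') (hadm g hg) (hadm g' hg')
    (fun i hi => ⟨hne _ _ (by omega), hne _ _ (by omega)⟩)
    ⟨n + 1, fun i hi => ⟨hne _ _ (by omega), hne _ _ (by omega)⟩⟩ (fun i => ?_) (n + 1)
  · rwa [rat, hM, hM] at this
  · rw [rat, hpp, hpp]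
    split_ifs
    · exact hgg'
    · simpa using hδ.le

theorem exists_limit_of_tends3 [TopologicalSpace K] [IsTopologicalGroup K] (hνG : νG.IsCompat)
    (hν : ν.IsCompat) (hι : DenseRange ι)
    (h : AsympHom (νG.comap ι) ν adm M) {g : G} {η : ℝ} (hη : 0 < η)
    (hg : ∀ d, νG (ι d * g⁻¹) < η → Tends3 ν M d 1 d⁻¹) :
    ∃ k, Tendsto (fun q : ℕ × D => M q.1 q.2) (nearFilter ι adm g) (𝓝 k) := by
  have hcau : ∀ ε > 0, ∃ δ > 0, ∃ N, ∀ n ≥ N, ∀ n' ≥ N, ∀ d d', adm n d → adm n' d' →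
      νG (ι d * g⁻¹) < δ → νG (ι d' * g⁻¹) < δ → ν (M n d * (M n' d')⁻¹) < ε := by
    intro ε hε
    obtain ⟨δ, hδ, N₁, hU⟩ := h.uniform_single (show 0 < ε / 4 by linarith)
    obtain ⟨d₀, hd₀⟩ := exists_approx hνG hι g (lt_min (half_pos hδ) hη)
    obtain ⟨N₂, hN₂⟩ := hg d₀ (hd₀.trans_le (min_le_right _ _)) (ε / 4) (by linarith)
    obtain ⟨N₃, hN₃⟩ := eventually_atTop.1 (h.adm_eventually d₀)
    have hclose : ∀ n ≥ max N₁ N₃, ∀ d, adm n d → νG (ι d * g⁻¹) < δ / 2 →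
        ν (M n d * (M n d₀)⁻¹) < ε / 4 := by
      intro n hn d hd hdg
      refine hU n (by omega) d d₀ hd (hN₃ n (by omega)) ?_
      have h1 := νG.triangle (ι d) g (ι d₀)
      rw [νG.map_div_comm g] at h1
      have h2 := hd₀.trans_le (min_le_left _ _)
      simp only [InvLength.comap_apply, map_mul, map_inv]
      linarith
    refine ⟨δ / 2, half_pos hδ, max N₁ (max N₂ N₃), fun n hn n' hn' d d' hd hd' hdg hdg' => ?_⟩
    have h1 := hclose n (by omega) d hd hdg
    have h2 := hclose n' (by omega) d' hd' hdg'
    -- Both `M n d₀` and `M n' d₀` are nearly inverse to the single element `M (n + n' + 2) d₀⁻¹`,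
    -- hence close to each other. The middle factor is trivial.
    have h3 := hN₂ n (n + 1) (n + n' + 2) (by omega) (by omega) (by omega)
    have h4 := hN₂ n' (n' + 1) (n + n' + 2) (by omega) (by omega) (by omega)
    rw [h.map_one, mul_one] at h3 h4
    set c := M (n + n' + 2) d₀⁻¹
    have h5 := ν.map_mul_le (M n d₀ * c) (M n' d₀ * c)⁻¹
    rw [ν.map_inv, show M n d₀ * c * (M n' d₀ * c)⁻¹ = M n d₀ * (M n' d₀)⁻¹ by group] at h5
    have h6 := ν.triangle (M n d) (M n d₀) (M n' d')
    have h7 := ν.triangle (M n d₀) (M n' d₀) (M n' d')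
    rw [ν.map_div_comm (M n' d₀)] at h7
    linarith
  have hpow : ∀ i : ℕ, (0 : ℝ) < (1 / 2) ^ i := fun i => by positivity
  choose δ hδ N hN using fun i : ℕ => hcau _ (hpow i)
  -- The moduli `δ` and `N` need not be monotone, so the `i`-th point meets all requirements up to
  -- `i`.
  have hex : ∀ i, ∃ n d, adm n d ∧ ∀ j ≤ i, N j ≤ n ∧ νG (ι d * g⁻¹) < δ j := by
    intro i
    obtain ⟨m, hm⟩ : ∃ m > 0, ∀ j ≤ i, m ≤ δ j := by
      obtain ⟨j, -, hj⟩ := Finset.exists_min_image (Finset.range (i + 1)) δ ⟨0, by simp⟩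
      exact ⟨δ j, hδ j, fun j' hj' => hj j' (by simpa using Nat.lt_succ_of_le hj')⟩
    obtain ⟨m', hm'⟩ : ∃ m', ∀ j ≤ i, N j ≤ m' :=
      ⟨(Finset.range (i + 1)).sup N, fun j hj =>
        Finset.le_sup (f := N) (by simpa using Nat.lt_succ_of_le hj)⟩
    obtain ⟨d, hd⟩ := exists_approx hνG hι g hm.1
    obtain ⟨n, hn⟩ := ((h.adm_eventually d).and (eventually_ge_atTop m')).exists
    exact ⟨n, d, hn.1, fun j hj => ⟨(hm' j hj).trans hn.2, hd.trans_le (hm.2 j hj)⟩⟩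
  choose n d hnd hex using hex
  obtain ⟨k, hk⟩ := hν.complete (fun i => M (n i) (d i)) (by
    intro ε hε
    obtain ⟨i, hi⟩ := exists_pow_lt_of_lt_one hε (show (1 / 2 : ℝ) < 1 by norm_num)
    exact ⟨i, fun j hj => (hN i _ (hex j i hj).1 _ (hex i i le_rfl).1 _ _ (hnd j) (hnd i)
      (hex j i hj).2 (hex i i le_rfl).2).trans hi⟩)
  refine ⟨k, hν.tendsto_iff.2 fun ε hε => (eventually_nearFilter hνG).2 ?_⟩
  obtain ⟨i, hi⟩ := exists_pow_lt_of_lt_one (half_pos hε) (show (1 / 2 : ℝ) < 1 by norm_num)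
  obtain ⟨j, hj⟩ := ((hν.tendsto_iff.1 hk (ε / 2) (half_pos hε)).and (eventually_ge_atTop i)).exists
  refine ⟨δ i, hδ i, N i, fun m hm e he heg => ?_⟩
  have h1 := hN i m hm _ (hex j i hj.2).1 e _ he (hnd j) heg (hex j i hj.2).2
  have h2 := ν.triangle (M m e) (M (n j) (d j)) k
  simp only at *
  linarith [hj.1]

/-- The `δ` of `exists_tends3` does not depend on the triple, so steps of length at most `δ` can be
iterated. The convergence thus spreads from a ball to the whole subgroup that it generates. -/
theorem exists_openSubgroup_limit [TopologicalSpace K] [IsTopologicalGroup K] (hνG : νG.IsCompat)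
    (hν : ν.IsCompat) (hι : DenseRange ι) (h : AsympHom (νG.comap ι) ν adm M)
    (hK : IsStronglyNSS K) :
    ∃ W : Subgroup G, IsOpen (W : Set G) ∧ ∀ g ∈ W, ∃ k,
      Tendsto (fun q : ℕ × D => M q.1 q.2) (nearFilter ι adm g) (𝓝 k) := by
  obtain ⟨η, hη, hNSS⟩ := hK.exists_bound hν
  obtain ⟨δ, hδ, hT⟩ := h.exists_tends3 hη fun c ⟨ε, hε, hc⟩ => hNSS c fun hlim => by
    obtain ⟨i, hi⟩ := (hν.tendsto_iff.1 hlim ε hε).exists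
    rw [inv_one, mul_one] at hi
    exact absurd (hc i) (not_le.2 hi)
  have hstep : ∀ g d : D, νG (ι d) ≤ δ → Tends3 ν M g 1 g⁻¹ → Tends3 ν M (g * d) 1 (g * d)⁻¹ := by
    intro g d hd hg
    have hgd : νG (ι g * ι d * (ι g)⁻¹) ≤ δ := by rwa [νG.map_conj']
    -- The move from `(g, 1, g⁻¹)` to `(g * d, 1, (g * d)⁻¹)` passes through `(g * d, d⁻¹, g⁻¹)`, so
    -- that only one partial product changes at a time.
    have h1 : Tends3 ν M (g * d) d⁻¹ g⁻¹ := by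
      refine hT _ _ _ g 1 g⁻¹ (by group) (by group) ?_ ?_ hg
      · simpa using hgd
      · simpa using hδ.le
    refine hT _ _ _ (g * d) d⁻¹ g⁻¹ (by group) (by group) ?_ ?_ h1
    · simpa using hδ.le
    · simpa using hgd
  have hone : Tends3 ν M 1 1 1⁻¹ := by
    intro ε hε
    refine ⟨0, fun a b c _ _ _ => ?_⟩
    simpa [h.map_one] using hε
  let W : Subgroup G := Subgroup.closure {g | νG g < δ}
  -- `W` need not be generated by elements of D, so the induction carries a neighbourhood of `w`; D
  -- is dense, and each step can be started at a point of D.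
  have hW : ∀ w ∈ W, ∃ θ > 0, ∀ d, νG (ι d * w⁻¹) < θ → Tends3 ν M d 1 d⁻¹ := by
    have hmul : ∀ x y : G, νG y < δ → (∃ θ > 0, ∀ d, νG (ι d * x⁻¹) < θ → Tends3 ν M d 1 d⁻¹) →
        ∃ θ > 0, ∀ d, νG (ι d * (x * y)⁻¹) < θ → Tends3 ν M d 1 d⁻¹ := by
      rintro x y hy ⟨θ, hθ, hx⟩
      refine ⟨(δ - νG y) / 2, by linarith, fun d hd => ?_⟩
      obtain ⟨d', hd'⟩ := exists_approx hνG hι x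
        (lt_min hθ (show 0 < (δ - νG y) / 2 by linarith))
      rw [show d = d' * (d'⁻¹ * d) by group]
      refine hstep d' _ ?_ (hx d' (hd'.trans_le (min_le_left _ _)))
      have h1 := hd'.trans_le (min_le_right _ _)
      have h2 := νG.map_mul_mul_le (ι d')⁻¹ (ι d) x⁻¹ (x * y)
      rw [inv_inv, νG.map_inv_mul] at h2
      have h3 := νG.map_le_add ((ι d')⁻¹ * ι d) (x⁻¹ * (x * y))
      rw [inv_mul_cancel_left] at h2 h3
      rw [map_mul, map_inv]
      linarith
    intro w hw
    induction hw using Subgroup.closure_induction_right with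
    | one =>
      refine ⟨δ, hδ, fun d hd => ?_⟩
      have := hstep 1 d (by simpa using hd.le) hone
      rwa [one_mul] at this
    | mul_right x hx y hy ih => exact hmul x y hy ih
    | mul_inv_cancel x hx y hy ih => exact hmul x y⁻¹ (by rw [νG.map_inv]; exact hy) ih
  refine ⟨W, W.isOpen_of_mem_nhds (g := 1) ?_, fun g hg => ?_⟩
  · exact hνG.mem_nhds_one.2 ⟨δ, hδ, fun a ha => Subgroup.subset_closure ha⟩
  · obtain ⟨θ, hθ, hd⟩ := hW g hg
    exact h.exists_limit_of_tends3 hνG hν hι hθ hd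

/-- The limit maps are continuous. -/
theorem continuous_limit [TopologicalSpace K] [IsTopologicalGroup K] (hνG : νG.IsCompat)
    (hν : ν.IsCompat) (hι : DenseRange ι) (h : AsympHom (νG.comap ι) ν adm M) {W : Subgroup G}
    {s : W → K} (hs : ∀ g : W,
      Tendsto (fun q : ℕ × D => M q.1 q.2) (nearFilter ι adm (g : G)) (𝓝 (s g))) :
    Continuous s := by
  rw [continuous_iff_continuousAt]
  intro g
  refine hν.tendsto_iff.2 fun ε hε => ?_
  obtain ⟨δ, hδ, N, hU⟩ := h.uniform_single (show 0 < ε / 3 by linarith)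
  have hg : ∀ᶠ g' : W in 𝓝 g, νG ((g' : G) * (g : G)⁻¹) < δ / 3 :=
    hνG.tendsto_iff.1 continuous_subtype_val.continuousAt (δ / 3) (by linarith)
  filter_upwards [hg] with g' hg'
  have hex := fun g : W => exists_of_eventually_nearFilter hνG hι h.adm_eventually
    (hν.tendsto_iff.1 (hs g) (ε / 3) (by linarith)) (show 0 < δ / 3 by linarith)
  obtain ⟨d, hd, hdn⟩ := hex g
  obtain ⟨d', hd', hdn'⟩ := hex g'
  obtain ⟨n, ⟨⟨h1, h2⟩, h3, h4⟩, hn⟩ := ((hdn.and hdn').and (eventually_ge_atTop N)).exists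
  have h5 := hU n hn d' d h3 h1 (by
    have t1 := νG.triangle (ι d') (g' : G) (ι d)
    have t2 := νG.triangle (g' : G) (g : G) (ι d)
    rw [νG.map_div_comm (g : G) (ι d)] at t2
    simp only [InvLength.comap_apply, _root_.map_mul, _root_.map_inv]
    linarith)
  have t1 := ν.triangle (s g') (M n d') (s g)
  have t2 := ν.triangle (M n d') (M n d) (s g)
  rw [ν.map_div_comm (s g') (M n d')] at t1
  simp only at h2 h4
  linarith

end AsympHom


/-! ### Transfer from the dense subgroup to the limit maps -/

theorem map_rat {A B : Type*} [Group A] [Group B] (φ : A →* B) (u v : ℕ → A) (n : ℕ) :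
    φ (rat u v n) = rat (fun i => φ (u i)) (fun i => φ (v i)) n := by
  rw [rat, rat, map_mul, map_inv, map_pp, map_pp]

theorem InvLength.isCau_comap {A B : Type*} [Group A] [Group B] (φ : A →* B) (ν : InvLength B)
    (r : ℕ → A) : (ν.comap φ).IsCau r ↔ ν.IsCau fun n => φ (r n) := by
  simp only [InvLength.IsCau, InvLength.comap_apply, _root_.map_mul, _root_.map_inv]

theorem InvLength.isCau_comap_rat {A B : Type*} [Group A] [Group B] (φ : A →* B)
    (ν : InvLength B) (u v : ℕ → A) :
    (ν.comap φ).IsCau (rat u v) ↔ ν.IsCau (rat (fun i => φ (u i)) fun i => φ (v i)) := by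
  rw [ν.isCau_comap]
  simp only [map_rat]

theorem eStar_iff_rat {A : Type*} [Group A] [TopologicalSpace A] [IsTopologicalGroup A]
    (x y : ℕ → A) : EStar A x y ↔ ∃ a, Tendsto (fun n => rat x y (n + 1)) atTop (𝓝 a) := by
  change (∃ g : A, _) ↔ _
  simp only [partialProd_eq_pp, rat]

theorem eStar_map {A B : Type*} [Group A] [TopologicalSpace A] [IsTopologicalGroup A] [Group B]
    [TopologicalSpace B] [IsTopologicalGroup B] (φ : A →* B) (hφ : Continuous φ) {x y : ℕ → A}
    (h : EStar A x y) : EStar B (fun n => φ (x n)) (fun n => φ (y n)) := by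
  obtain ⟨a, ha⟩ := (eStar_iff_rat x y).1 h
  refine (eStar_iff_rat _ _).2 ⟨φ a, ?_⟩
  simp only [← map_rat]
  exact (hφ.tendsto a).comp ha

theorem eStar_subgroup {A : Type*} [Group A] [TopologicalSpace A] [IsTopologicalGroup A]
    (W : Subgroup A) (hW : IsClosed (W : Set A)) {x y : ℕ → W}
    (h : EStar A (fun n => (x n : A)) (fun n => (y n : A))) : EStar W x y := by
  obtain ⟨a, ha⟩ := (eStar_iff_rat _ _).1 h
  have hcoe : ∀ n, rat (fun n => (x n : A)) (fun n => (y n : A)) (n + 1) = (rat x y (n + 1) : W) :=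
    fun n => (map_rat W.subtype x y (n + 1)).symm
  simp only [hcoe] at ha
  have haW : a ∈ W := hW.mem_of_tendsto ha (Eventually.of_forall fun n => (rat x y (n + 1)).2)
  exact (eStar_iff_rat _ _).2 ⟨⟨a, haW⟩, tendsto_subtype_rng.2 ha⟩

theorem InvLength.isCau_rat_spread_id {D : Type*} [Group D] {L : InvLength D} {k : ℕ → ℕ} (hk : StrictMono k)
    (x y : ℕ → D) : L.IsCau (rat (spread k x) (spread k y)) ↔ L.IsCau (rat x y) :=
  L.isCau_rat_spread hk (fun _ g => g) (fun _ => rfl) x y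

theorem InvLength.isCau_rat_congr_iff {K : Type*} [Group K] (ν : InvLength K) {u v u' v' : ℕ → K}
    (hu : ∀ n, ν (u n * (u' n)⁻¹) ≤ (1 / 2) ^ n) (hv : ∀ n, ν (v n * (v' n)⁻¹) ≤ (1 / 2) ^ n) :
    ν.IsCau (rat u v) ↔ ν.IsCau (rat u' v') := by
  refine ⟨ν.isCau_rat_congr summable_geometric_two hu hv,
    ν.isCau_rat_congr summable_geometric_two (fun n => ?_) fun n => ?_⟩
  · rw [ν.map_div_comm]; exact hu n
  · rw [ν.map_div_comm]; exact hv n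

section Transfer

variable {D G K : Type*} [Group D] [Group G] [TopologicalSpace G] [IsTopologicalGroup G]
  [Group K] [TopologicalSpace K] [IsTopologicalGroup K] {ι : D →* G} {adm : ℕ → D → Prop}
  {νG : InvLength G} {ν : InvLength K} {M : ℕ → D → K}

/-- Each limit gives an element of D that works at all sufficiently late positions; a diagonal
choice makes the positions increasing and the errors summable. -/
theorem exists_sparse_approx (hνG : νG.IsCompat) (hν : ν.IsCompat) (hι : DenseRange ι)
    (hadm : ∀ d, ∀ᶠ n in atTop, adm n d) {x y : ℕ → G} {sx sy : ℕ → K}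
    (hx : ∀ n, Tendsto (fun q : ℕ × D => M q.1 q.2) (nearFilter ι adm (x n)) (𝓝 (sx n)))
    (hy : ∀ n, Tendsto (fun q : ℕ × D => M q.1 q.2) (nearFilter ι adm (y n)) (𝓝 (sy n))) :
    ∃ (k : ℕ → ℕ) (x' y' : ℕ → D), StrictMono k ∧
      (∀ n, νG (ι (x' n) * (x n)⁻¹) ≤ (1 / 2) ^ n) ∧ (∀ n, νG (ι (y' n) * (y n)⁻¹) ≤ (1 / 2) ^ n) ∧
      (∀ n, adm (k n) (x' n)) ∧ (∀ n, adm (k n) (y' n)) ∧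
      (∀ n, ν (M (k n) (x' n) * (sx n)⁻¹) ≤ (1 / 2) ^ n) ∧
      (∀ n, ν (M (k n) (y' n) * (sy n)⁻¹) ≤ (1 / 2) ^ n) := by
  have hpow : ∀ i : ℕ, (0 : ℝ) < (1 / 2) ^ i := fun i => by positivity
  choose x' hx' hx'' using fun n => exists_of_eventually_nearFilter hνG hι hadm
    (hν.tendsto_iff.1 (hx n) _ (hpow n)) (hpow n)
  choose y' hy' hy'' using fun n => exists_of_eventually_nearFilter hνG hι hadm
    (hν.tendsto_iff.1 (hy n) _ (hpow n)) (hpow n)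
  obtain ⟨k, hk, h⟩ := extraction_forall_of_eventually fun n => (hx'' n).and (hy'' n)
  exact ⟨k, x', y', hk, fun n => (hx' n).le, fun n => (hy' n).le, fun n => (h n).1.1,
    fun n => (h n).2.1, fun n => (h n).1.2.le, fun n => (h n).2.2.le⟩

theorem spread_adm {k : ℕ → ℕ} (hk : StrictMono k) (hadm : ∀ n, adm n 1) {x : ℕ → D}
    (hx : ∀ n, adm (k n) (x n)) (i : ℕ) : adm i (spread k x i) := by
  by_cases hi : i ∈ Set.range k
  · obtain ⟨n, rfl⟩ := hi
    rw [spread_apply hk]; exact hx n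
  · rw [spread_of_not_mem _ hi]; exact hadm i

theorem AsympHom.isCau_limit (h : AsympHom (νG.comap ι) ν adm M) (hνG : νG.IsCompat)
    (hν : ν.IsCompat) (hι : DenseRange ι) {x y : ℕ → G} {sx sy : ℕ → K}
    (hx : ∀ n, Tendsto (fun q : ℕ × D => M q.1 q.2) (nearFilter ι adm (x n)) (𝓝 (sx n)))
    (hy : ∀ n, Tendsto (fun q : ℕ × D => M q.1 q.2) (nearFilter ι adm (y n)) (𝓝 (sy n)))
    (hxy : νG.IsCau (rat x y)) : ν.IsCau (rat sx sy) := by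
  obtain ⟨k, x', y', hk, h1, h2, h3, h4, h5, h6⟩ :=
    exists_sparse_approx hνG hν hι h.adm_eventually hx hy
  rw [← νG.isCau_rat_congr_iff h1 h2, ← νG.isCau_comap_rat ι,
    ← InvLength.isCau_rat_spread_id hk] at hxy
  rw [← ν.isCau_rat_congr_iff h5 h6, ← ν.isCau_rat_spread hk M h.map_one]
  exact h.hom _ _ (spread_adm hk h.adm_one h3) (spread_adm hk h.adm_one h4) hxy

/-- The homomorphism property together with its converse, in terms of an error `Δ`. -/
structure AsympReduction (L : InvLength D) (ν : InvLength K) (adm : ℕ → D → Prop) (M : ℕ → D → K)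
    (Δ : ℕ → D → D → ℝ) : Prop extends AsympHom L ν adm M where
  nonneg : ∀ n g h, 0 ≤ Δ n g h
  error : ∀ x y : ℕ → D, (∀ n, adm n (x n)) → (∀ n, adm n (y n)) → L.IsCau (rat x y) →
    Tendsto (fun n => Δ n (x n) (y n)) atTop (𝓝 0)
  isCau : ∀ x y : ℕ → D, (∀ n, adm n (x n)) → (∀ n, adm n (y n)) →
    ν.IsCau (rat (fun n => M n (x n)) fun n => M n (y n)) →
    Tendsto (fun n => Δ n (x n) (y n)) atTop (𝓝 0) → L.IsCau (rat x y)

/-- Counterexamples at sparse positions with summable distances would have a Cauchy ratio, against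
the vanishing of the error along such pairs. -/
theorem AsympReduction.uniform_error {K : Type*} [Group K] {ν : InvLength K} {M : ℕ → D → K}
    {L : InvLength D} {Δ : ℕ → D → D → ℝ}
    (h : AsympReduction L ν adm M Δ) {ε : ℝ} (hε : 0 < ε) :
    ∃ δ > 0, ∃ N, ∀ n ≥ N, ∀ g g', adm n g → adm n g' → L (g * g'⁻¹) < δ → Δ n g g' < ε := by
  by_contra hcon
  push Not at hcon
  have hfreq : ∀ j : ℕ, ∃ᶠ n in atTop, ∃ g g', adm n g ∧ adm n g' ∧ L (g * g'⁻¹) < (1 / 2) ^ j ∧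
      ε ≤ Δ n g g' := by
    intro j
    rw [frequently_atTop]
    intro N
    obtain ⟨n, hn, g, g', h1⟩ := hcon ((1 / 2) ^ j) (by positivity) N
    exact ⟨n, hn, g, g', h1⟩
  obtain ⟨k, hk, hkj⟩ := extraction_forall_of_frequently hfreq
  choose g g' hg hg' hL hΔ using hkj
  have hlim := h.error _ _ (spread_adm hk h.adm_one hg) (spread_adm hk h.adm_one hg')
    ((InvLength.isCau_rat_spread_id hk g g').2
      (L.isCau_rat_of_summable summable_geometric_two fun j => (hL j).le))
  obtain ⟨j, hj⟩ := ((hlim.comp hk.tendsto_atTop).eventually_lt_const hε).exists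
  simp only [Function.comp, spread_apply hk] at hj
  exact absurd (hΔ j) (not_le.2 hj)

/-- The hypothesis `h0` makes the approximating entries close, so `uniform_error` supplies the
oscillation condition that the ratios of the limits do not see. -/
theorem AsympReduction.isCau_of_limit {Δ : ℕ → D → D → ℝ}
    (h : AsympReduction (νG.comap ι) ν adm M Δ) (hνG : νG.IsCompat)
    (hν : ν.IsCompat) (hι : DenseRange ι) {x y : ℕ → G} {sx sy : ℕ → K}
    (hx : ∀ n, Tendsto (fun q : ℕ × D => M q.1 q.2) (nearFilter ι adm (x n)) (𝓝 (sx n)))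
    (hy : ∀ n, Tendsto (fun q : ℕ × D => M q.1 q.2) (nearFilter ι adm (y n)) (𝓝 (sy n)))
    (hxy : ν.IsCau (rat sx sy)) (h0 : Tendsto (fun n => νG (x n * (y n)⁻¹)) atTop (𝓝 0)) :
    νG.IsCau (rat x y) := by
  obtain ⟨k, x', y', hk, h1, h2, h3, h4, h5, h6⟩ :=
    exists_sparse_approx hνG hν hι h.adm_eventually hx hy
  rw [← νG.isCau_rat_congr_iff h1 h2, ← νG.isCau_comap_rat ι, ← InvLength.isCau_rat_spread_id hk]
  rw [← ν.isCau_rat_congr_iff h5 h6, ← ν.isCau_rat_spread hk M h.map_one] at hxy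
  refine h.isCau _ _ (spread_adm hk h.adm_one h3) (spread_adm hk h.adm_one h4) hxy ?_
  rw [Metric.tendsto_atTop]
  intro ε hε
  obtain ⟨δ, hδ, N, hU⟩ := h.uniform_error hε
  have hsmall : Tendsto (fun n => νG (ι (x' n) * (ι (y' n))⁻¹)) atTop (𝓝 0) := by
    have hgeo : Tendsto (fun n : ℕ => ((1 : ℝ) / 2) ^ n) atTop (𝓝 0) :=
      summable_geometric_two.tendsto_atTop_zero
    have hlim : Tendsto (fun n : ℕ => ((1 : ℝ) / 2) ^ n + (νG (x n * (y n)⁻¹) + (1 / 2) ^ n))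
        atTop (𝓝 0) := by simpa using hgeo.add (h0.add hgeo)
    refine squeeze_zero (fun n => νG.map_nonneg _) (fun n => ?_) hlim
    have t1 := νG.triangle (ι (x' n)) (x n) (ι (y' n))
    have t2 := νG.triangle (x n) (y n) (ι (y' n))
    rw [νG.map_div_comm (y n)] at t2
    linarith [h1 n, h2 n]
  obtain ⟨J, hJ⟩ := eventually_atTop.1 (hsmall.eventually_lt_const hδ)
  refine ⟨max N (k J), fun i hi => ?_⟩
  rw [Real.dist_eq, sub_zero, abs_of_nonneg (h.nonneg _ _ _)]
  refine hU i (by omega) _ _ (spread_adm hk h.adm_one h3 i) (spread_adm hk h.adm_one h4 i) ?_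
  by_cases hir : i ∈ Set.range k
  · obtain ⟨n, rfl⟩ := hir
    rw [spread_apply hk, spread_apply hk]
    have := hJ n (hk.le_iff_le.1 ((le_max_right _ _).trans hi))
    simpa using this
  · rw [spread_of_not_mem _ hir, spread_of_not_mem _ hir]
    simpa using hδ

end Transfer

/-! ### Assembly of the forward direction -/

theorem exists_asympReduction {D G K : Type*} [Group D] [Countable D] [Group G]
    [TopologicalSpace G] [IsTopologicalGroup G] [Group K] [TopologicalSpace K]
    [IsTopologicalGroup K] [PolishSpace K] (ι : D →* G) {νG : InvLength G} {ν : InvLength K}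
    (hνG : νG.IsCompat) (hν : ν.IsCompat) (hred : BorelReducible (E G) (E K)) :
    ∃ (adm : ℕ → D → Prop) (M : ℕ → D → K) (Δ : ℕ → D → D → ℝ),
      AsympReduction (νG.comap ι) ν adm M Δ := by
  obtain ⟨f, hf, hfr⟩ := hred
  -- With D discrete, finite conditions on sequences are open; the topology of G enters only through
  -- `ι`.
  let tD : TopologicalSpace D := ⊥
  have : DiscreteTopology D := ⟨rfl⟩
  borelize (ℕ → D) K
  obtain ⟨e, he⟩ := exists_surjective_nat D
  -- Finite sets that exhaust D; each contains `1` so that entries may be left trivial.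
  let F : ℕ → Set D := fun n => insert 1 (e '' Set.Iic n)
  have hcont : Continuous fun (v : ℕ → D) (i : ℕ) => ι (v i) :=
    continuous_pi fun i => continuous_of_discreteTopology.comp (continuous_apply i)
  let f' : (ℕ → D) → ℕ → K := fun v => f fun i => ι (v i)
  have hf' : ∀ k, Measurable fun v => f' v k := fun k =>
    ((continuous_apply k).borel_measurable.comp hf).comp hcont.borel_measurable
  have hE : ∀ s ∈ evConst D, ∀ v, ν.IsCau fun k => f' (s * v) k * (f' v k)⁻¹ := by
    rintro s ⟨N, hN⟩ v
    rw [← hν.e_iff, ← hfr _ _]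
    refine ⟨ι (s N), tendsto_const_nhds.congr' ?_⟩
    filter_upwards [eventually_ge_atTop N] with i hi
    simp [hN i hi]
  obtain ⟨z, p, M, Δ, hp, hM, hΔ, h⟩ := exists_blocks hν f' hf' hE F
    (fun n => ((Set.finite_Iic n).image e).insert 1) fun n => Set.mem_insert _ _
  have key : ∀ x y : ℕ → D, (ν.IsCau fun k => f' (stretch p x * z) k * (f' (stretch p y * z) k)⁻¹) ↔
      (νG.comap ι).IsCau (rat x y) := by
    intro x y
    rw [← hν.e_iff, ← hfr _ _, hνG.e_iff, ← InvLength.isCau_rat_spread_id hp,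
      ← InvLength.isCau_succ_iff (r := rat (spread p x) (spread p y)), νG.isCau_comap]
    have hs : ∀ x : ℕ → D, ∀ i, pp (spread p x) (i + 1) = stretch p x i := fun x i =>
      pp_spread hp (fun _ g => g) (fun _ => rfl) x (i + 1)
    simp only [rat, hs, Pi.mul_apply, map_mul, map_inv, mul_inv_rev, mul_assoc,
      mul_inv_cancel_left]
  refine ⟨fun n g => g ∈ F n, M, Δ, ⟨fun n => Set.mem_insert _ _, fun g => ?_, hM, ?_⟩, hΔ, ?_, ?_⟩
  · obtain ⟨n, rfl⟩ := he g
    filter_upwards [eventually_ge_atTop n] with i hi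
    exact Set.mem_insert_of_mem _ ⟨n, hi, rfl⟩
  · exact fun x y hx hy hxy => ((h x y hx hy).1 ((key x y).2 hxy)).1
  · exact fun x y hx hy hxy => ((h x y hx hy).1 ((key x y).2 hxy)).2
  · exact fun x y hx hy h1 h2 => (key x y).1 ((h x y hx hy).2 ⟨h1, h2⟩)

theorem exists_countable_dense_subgroup (G : Type*) [Group G] [TopologicalSpace G]
    [TopologicalSpace.SeparableSpace G] : ∃ D : Subgroup G, Countable D ∧ DenseRange D.subtype := by
  obtain ⟨s, hs, hd⟩ := TopologicalSpace.exists_countable_dense G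
  have : Countable s := hs.to_subtype
  have : Countable (FreeGroup s) := Quot.mk_surjective.countable
  have hc : Countable (Subgroup.closure s) := by
    rw [FreeGroup.closure_eq_range]
    exact (FreeGroup.lift _).rangeRestrict_surjective.countable
  refine ⟨Subgroup.closure s, hc, ?_⟩
  have hr : Set.range (Subgroup.closure s).subtype = Subgroup.closure s := by simp
  rw [DenseRange, hr]
  exact hd.mono Subgroup.subset_closure

theorem exists_isPreRigid {G : Type*} [Group G] [TopologicalSpace G] [IsTopologicalGroup G]
    [PolishSpace G] (hG : IsTSI G)
    {Hm : ℕ → Type*} [∀ m, Group (Hm m)] [∀ m, TopologicalSpace (Hm m)]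
    [∀ m, IsTopologicalGroup (Hm m)] [∀ m, PolishSpace (Hm m)]
    (hTSI : ∀ m, IsTSI (Hm m)) (hNSS : ∀ m, IsStronglyNSS (Hm m))
    (H : Subgroup (∀ m, Hm m)) (hH : IsClosed (H : Set (∀ m, Hm m)))
    (hred : BorelReducible (E G) (E H)) :
    ∃ (W : ℕ → Subgroup G) (p : ∀ m, W m → Hm m), IsPreRigid H W p := by
  have : PolishSpace H := hH.polishSpace
  obtain ⟨νG, hνG⟩ := hG.exists_isCompat
  obtain ⟨ν, hν⟩ := ((isTSI_pi hTSI).subgroup H).exists_isCompat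
  choose νm hνm using fun m => (hTSI m).exists_isCompat
  obtain ⟨D, hDc, hD⟩ := exists_countable_dense_subgroup G
  obtain ⟨adm, M, Δ, h⟩ := exists_asympReduction D.subtype hνG hν hred
  let φ : ∀ m, H →* Hm m := fun m => (Pi.evalMonoidHom Hm m).comp H.subtype
  have hφ : ∀ m, Continuous (φ m) := fun m => (continuous_apply m).comp continuous_subtype_val
  have hm : ∀ m, AsympHom (νG.comap D.subtype) (νm m) adm fun n d => φ m (M n d) := fun m =>
    { adm_one := h.adm_one
      adm_eventually := h.adm_eventually
      map_one := fun n => by rw [h.map_one, map_one]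
      hom := fun x y hx hy hxy => by
        rw [← (hνm m).eStar_iff]
        exact eStar_map (φ m) (hφ m) ((hν.eStar_iff _ _).2 (h.hom x y hx hy hxy)) }
  choose W hWo p hp using fun m => (hm m).exists_openSubgroup_limit hνG (hνm m) hD (hNSS m)
  have hp1 : ∀ m, p m 1 (W m).one_mem = 1 := by
    intro m
    refine ((hνm m).eq_of_forall_lt fun ε hε => ?_).symm
    obtain ⟨δ, hδ, N, hN⟩ := (eventually_nearFilter hνG).1
      ((hνm m).tendsto_iff.1 (hp m 1 (W m).one_mem) ε hε)
    have := hN N le_rfl 1 (h.adm_one N) (by simpa using hδ)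
    simpa [h.map_one] using this
  have hmemW : ∀ (g : ↥(⨅ m, W m)) (m : ℕ), (g : G) ∈ W m := fun g m => Subgroup.mem_iInf.1 g.2 m
  have hlim : ∀ g : ↥(⨅ m, W m), Tendsto (fun q : ℕ × D => (M q.1 q.2 : ∀ m, Hm m))
      (nearFilter D.subtype adm (g : G)) (𝓝 fun m => p m g (hmemW g m)) := fun g =>
    tendsto_pi_nhds.2 fun m => hp m g (hmemW g m)
  have hmemH : ∀ g : ↥(⨅ m, W m), (fun m => p m g (hmemW g m)) ∈ H := fun g => by
    have := nearFilter_neBot (ι := D.subtype) hνG hD h.adm_eventually (g : G)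
    exact hH.mem_of_tendsto (hlim g) (Eventually.of_forall fun q => (M q.1 q.2).2)
  let S : ↥(⨅ m, W m) → H := fun g => ⟨_, hmemH g⟩
  have hS : ∀ g : ↥(⨅ m, W m), Tendsto (fun q : ℕ × D => M q.1 q.2)
      (nearFilter D.subtype adm (g : G)) (𝓝 (S g)) := fun g => tendsto_subtype_rng.2 (hlim g)
  -- Open subgroups are closed, so limits in G of ratios from the intersection stay in it, although
  -- it need not be open.
  have hWc : IsClosed ((⨅ m, W m : Subgroup G) : Set G) := by
    rw [Subgroup.coe_iInf]
    exact isClosed_iInter fun m => (W m).isClosed_of_isOpen (hWo m)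
  have hzero : ∀ x y : ℕ → ↥(⨅ m, W m), EZero ↥(⨅ m, W m) x y ↔
      Tendsto (fun n => νG ((x n : G) * (y n : G)⁻¹)) atTop (𝓝 0) := by
    intro x y
    change Tendsto _ _ _ ↔ _
    rw [tendsto_subtype_rng]
    change Tendsto (fun n => ((x n : G)⁻¹ * (y n : G))) atTop (𝓝 1) ↔ _
    rw [InvLength.tendsto_iff_of_nhds hνG.nhds_one]
    simp only [inv_one, mul_one, νG.map_inv_mul]
  refine ⟨W, fun m g => p m g g.2, hWo, fun m => ?_, hp1, fun m x y hxy => ?_, S, fun _ _ => rfl,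
    fun x y => ?_⟩
  · exact (hm m).continuous_limit hνG (hνm m) hD fun g => hp m g g.2
  · rw [(hνm m).eStar_iff]
    refine (hm m).isCau_limit hνG (hνm m) hD (x := fun n => (x n : G)) (y := fun n => (y n : G))
      (fun n => hp m _ (x n).2) (fun n => hp m _ (y n).2) ?_
    rw [← hνG.eStar_iff]
    exact eStar_map (W m).subtype continuous_subtype_val hxy
  · change _ ↔ EStar H (omegaMap S x) (omegaMap S y) ∧ EZero ↥(⨅ m, W m) x y
    rw [hzero, hν.eStar_iff]
    constructor
    · intro hxy
      have h1 := (hνG.eStar_iff _ _).1 (eStar_map (⨅ m, W m).subtype continuous_subtype_val hxy)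
      exact ⟨h.isCau_limit hνG hν hD (fun n => hS (x n)) (fun n => hS (y n)) h1,
        νG.tendsto_of_isCau_rat h1⟩
    · rintro ⟨h1, h2⟩
      refine eStar_subgroup _ hWc ((hνG.eStar_iff _ _).2 ?_)
      exact h.isCau_of_limit hνG hν hD (fun n => hS (x n)) (fun n => hS (y n)) h1 h2


/-! ### From E(X;0) to the unit interval -/

section Bump

variable {X : Type*} [PseudoMetricSpace X] (a : ℕ → X) (ε : ℝ)

/-- The minimum of `ε` and the numbers `dist x (a j) - ε / 2`, for `j < i`. -/
noncomputable def capDist : ℕ → X → ℝ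
  | 0, _ => ε
  | i + 1, x => min (capDist i x) (dist x (a i) - ε / 2)

/-- A bump function, supported on the points of the ball of radius `ε` around `a i` that have
distance at least `ε / 2` to the preceding centres. -/
noncomputable def bump (i : ℕ) (x : X) : ℝ := max 0 (min (ε - dist x (a i)) (capDist a ε i x))

theorem capDist_le (i : ℕ) (x y : X) : capDist a ε i x ≤ capDist a ε i y + dist x y := by
  induction i with
  | zero => exact le_add_of_nonneg_right dist_nonneg
  | succ i ih =>
    rw [capDist, capDist, ← min_add_add_right]
    exact min_le_min ih (by linarith [dist_triangle x y (a i)])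

theorem bump_le (i : ℕ) (x y : X) : bump a ε i x ≤ bump a ε i y + dist x y := by
  rw [bump, bump, ← max_add_add_right, ← min_add_add_right]
  refine max_le_max (by simp) (min_le_min ?_ (capDist_le a ε i x y))
  linarith [dist_triangle_left y (a i) x]

theorem abs_bump_sub_le (i : ℕ) (x y : X) : |bump a ε i x - bump a ε i y| ≤ dist x y := by
  rw [abs_le]
  have h1 := bump_le a ε i x y
  have h2 := bump_le a ε i y x
  rw [dist_comm] at h2
  constructor <;> linarith

theorem bump_nonneg (i : ℕ) (x : X) : 0 ≤ bump a ε i x := le_max_left _ _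

variable {ε} in
theorem bump_le_self (hε : 0 < ε) (i : ℕ) (x : X) : bump a ε i x ≤ ε :=
  max_le hε.le ((min_le_left _ _).trans (by linarith [dist_nonneg (x := x) (y := a i)]))

theorem continuous_bump (i : ℕ) : Continuous (bump a ε i) :=
  (LipschitzWith.of_dist_le_mul (K := 1) fun x y => by
    simpa [Real.dist_eq] using abs_bump_sub_le a ε i x y).continuous

theorem capDist_le_of_lt {i j : ℕ} (h : j < i) (x : X) : capDist a ε i x ≤ dist x (a j) - ε / 2 := by
  induction i, h using Nat.le_induction with
  | base => exact min_le_right _ _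
  | succ i _ ih => exact (min_le_left _ _).trans ih

variable {a ε}

/-- Once a centre comes within `ε / 2` of `x`, all later bumps are cut off at `x`. -/
theorem bump_eventually_zero (ha : DenseRange a) (hε : 0 < ε) (x : X) :
    ∃ I, ∀ i ≥ I, bump a ε i x = 0 := by
  obtain ⟨j, hj⟩ := ha.exists_dist_lt x (half_pos hε)
  refine ⟨j + 1, fun i hi => max_eq_left ((min_le_right _ _).trans ?_)⟩
  have := capDist_le_of_lt a ε (Nat.lt_of_succ_le hi) x
  linarith

theorem le_capDist {i : ℕ} {x : X} {c : ℝ} (hc : c ≤ ε) (h : ∀ j < i, c ≤ dist x (a j) - ε / 2) :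
    c ≤ capDist a ε i x := by
  induction i with
  | zero => exact hc
  | succ i ih =>
    exact le_min (ih fun j hj => h j (hj.trans i.lt_succ_self)) (h i i.lt_succ_self)

/-- Take the first centre within `3 / 4 * ε` of `x`. The earlier centres are too far away to lower
the bump at `x` below `ε / 4`, and `y` is outside its support. -/
theorem exists_bump_separates (ha : DenseRange a) (hε : 0 < ε) {x y : X} (h : 2 * ε ≤ dist x y) :
    ∃ i, ε / 4 ≤ bump a ε i x ∧ bump a ε i y = 0 := by
  classical
  have hex : ∃ i, dist x (a i) < 3 / 4 * ε := ha.exists_dist_lt x (by linarith)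
  refine ⟨Nat.find hex, ?_, ?_⟩
  · have h1 := Nat.find_spec hex
    refine le_max_of_le_right (le_min (by linarith) (le_capDist (by linarith) fun j hj => ?_))
    have := not_lt.1 (Nat.find_min hex hj)
    linarith
  · have h1 := Nat.find_spec hex
    refine max_eq_left ((min_le_left _ _).trans ?_)
    linarith [dist_triangle_right x y (a (Nat.find hex))]

end Bump

/-- Convergence to `0` of distances in a separable metric space reduces to the same question in the
unit interval. -/
theorem exists_reduction_unitInterval (X : Type*) [PseudoMetricSpace X]
    [TopologicalSpace.SeparableSpace X] [Nonempty X] :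
    ∃ t : (ℕ → X) → ℕ → unitInterval, Continuous t ∧ ∀ x y : ℕ → X,
      Tendsto (fun n => dist (x n) (y n)) atTop (𝓝 0) ↔
        Tendsto (fun k => dist (t x k) (t y k)) atTop (𝓝 0) := by
  obtain ⟨a, ha⟩ := TopologicalSpace.exists_dense_seq X
  let ε : ℕ → ℝ := fun j => (1 / 2) ^ j
  have hε : ∀ j, 0 < ε j := fun j => by positivity
  have hε1 : ∀ j, ε j ≤ 1 := fun j => pow_le_one₀ (by norm_num) (by norm_num)
  -- A coordinate `k` codes an entry `n'`, a scale `j'` and a bump `i'`.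
  let n' : ℕ → ℕ := fun k => k.unpair.1
  let j' : ℕ → ℕ := fun k => k.unpair.2.unpair.1
  let i' : ℕ → ℕ := fun k => k.unpair.2.unpair.2
  let t : (ℕ → X) → ℕ → unitInterval := fun x k => ⟨bump a (ε (j' k)) (i' k) (x (n' k)),
    bump_nonneg _ _ _ _, (bump_le_self a (hε _) _ _).trans (hε1 _)⟩
  have htd : ∀ x y k, dist (t x k) (t y k) = |bump a (ε (j' k)) (i' k) (x (n' k)) -
    bump a (ε (j' k)) (i' k) (y (n' k))| := fun x y k => rfl
  refine ⟨t, ?_, fun x y => ⟨fun h => ?_, fun h => ?_⟩⟩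
  · exact continuous_pi fun k =>
      ((continuous_bump a _ _).comp (continuous_apply (n' k))).subtype_mk _
  · rw [Metric.tendsto_atTop] at h
    rw [Metric.tendsto_nhds]
    intro θ hθ
    obtain ⟨N, hN⟩ := h θ hθ
    obtain ⟨J, hJ⟩ := exists_pow_lt_of_lt_one hθ (show (1 / 2 : ℝ) < 1 by norm_num)
    choose I hI using fun (x : X) (j : ℕ) => bump_eventually_zero ha (hε j) x
    let B := (Finset.range N ×ˢ Finset.range J).sup fun q => max (I (x q.1) q.2) (I (y q.1) q.2)
    -- Only finitely many coordinates can differ by `θ`: late entries are close and bumps are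
    -- 1-Lipschitz, fine scales have small bumps, and each remaining entry and scale has only
    -- finitely many nonzero bumps.
    have hfin : (Set.Iio N ×ˢ Set.Iio J ×ˢ Set.Iio B).Finite :=
      (Set.finite_Iio N).prod ((Set.finite_Iio J).prod (Set.finite_Iio B))
    have hinj : Function.Injective fun k => (n' k, j' k, i' k) := by
      intro k k' hkk'
      simp only [Prod.mk.injEq] at hkk'
      have h2 : k.unpair.2 = k'.unpair.2 := by
        rw [← Nat.pair_unpair k.unpair.2, ← Nat.pair_unpair k'.unpair.2]
        exact congrArg₂ Nat.pair hkk'.2.1 hkk'.2.2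
      rw [← Nat.pair_unpair k, ← Nat.pair_unpair k', h2]
      exact congrArg₂ Nat.pair hkk'.1 rfl
    rw [← Nat.cofinite_eq_atTop]
    refine (hfin.preimage hinj.injOn).subset fun k hk => ?_
    have hk : θ ≤ dist (t x k) (t y k) := by
      have : ¬ dist (dist (t x k) (t y k)) 0 < θ := hk
      rwa [Real.dist_eq, sub_zero, abs_of_nonneg dist_nonneg, not_lt] at this
    rw [htd] at hk
    have h1 : n' k < N := by
      by_contra hcon
      have h2 := hN (n' k) (not_lt.1 hcon)
      rw [Real.dist_eq, sub_zero, abs_of_nonneg dist_nonneg] at h2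
      linarith [abs_bump_sub_le a (ε (j' k)) (i' k) (x (n' k)) (y (n' k))]
    have h2 : j' k < J := by
      by_contra hcon
      have h3 : ε (j' k) ≤ (1 / 2) ^ J :=
        pow_le_pow_of_le_one (by norm_num) (by norm_num) (not_lt.1 hcon)
      have h4 := bump_le_self a (hε (j' k)) (i' k) (x (n' k))
      have h5 := bump_le_self a (hε (j' k)) (i' k) (y (n' k))
      have h6 := bump_nonneg a (ε (j' k)) (i' k) (x (n' k))
      have h7 := bump_nonneg a (ε (j' k)) (i' k) (y (n' k))
      have h8 := abs_le.2 (show -(ε (j' k)) ≤ bump a (ε (j' k)) (i' k) (x (n' k)) -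
        bump a (ε (j' k)) (i' k) (y (n' k)) ∧ bump a (ε (j' k)) (i' k) (x (n' k)) -
        bump a (ε (j' k)) (i' k) (y (n' k)) ≤ ε (j' k) by constructor <;> linarith)
      linarith
    refine ⟨h1, h2, ?_⟩
    change i' k < B
    by_contra hcon
    have h3 : max (I (x (n' k)) (j' k)) (I (y (n' k)) (j' k)) ≤ B :=
      Finset.le_sup (f := fun q : ℕ × ℕ => max (I (x q.1) q.2) (I (y q.1) q.2))
        (b := (n' k, j' k)) (by simp [h1, h2])
    rw [hI _ _ _ ((le_max_left _ _).trans (h3.trans (not_lt.1 hcon))),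
      hI _ _ _ ((le_max_right _ _).trans (h3.trans (not_lt.1 hcon)))] at hk
    simp only [sub_zero, abs_zero] at hk
    linarith
  · rw [Metric.tendsto_atTop] at h ⊢
    intro θ hθ
    obtain ⟨j, hj⟩ := exists_pow_lt_of_lt_one (half_pos hθ) (show (1 / 2 : ℝ) < 1 by norm_num)
    obtain ⟨N, hN⟩ := h (ε j / 4) (by linarith [hε j])
    refine ⟨N, fun n hn => ?_⟩
    rw [Real.dist_eq, sub_zero, abs_of_nonneg dist_nonneg]
    by_contra hcon
    have h2 : 2 * ε j ≤ dist (x n) (y n) := by simp only [ε]; linarith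
    obtain ⟨i, h3, h4⟩ := exists_bump_separates ha (hε j) h2
    have h5 := hN (Nat.pair n (Nat.pair j i)) (hn.trans (Nat.left_le_pair _ _))
    rw [Real.dist_eq, sub_zero, abs_of_nonneg dist_nonneg, htd] at h5
    simp only [n', j', i', Nat.unpair_pair, h4, sub_zero] at h5
    linarith [le_abs_self (bump a (ε j) i (x n))]

/-! ### The converse: compactness, increments and interleaving -/

theorem exists_lt_of_lt_of_compact {Z : Type*} [TopologicalSpace Z] [CompactSpace Z] {f g : Z → ℝ}
    (hf : Continuous f) (hg : Continuous g) (hf0 : ∀ z, 0 ≤ f z) (h : ∀ z, f z = 0 → g z = 0)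
    {ε : ℝ} (hε : 0 < ε) : ∃ δ > 0, ∀ z, f z < δ → g z < ε := by
  have hc : IsCompact {z | ε ≤ g z} := (isClosed_le continuous_const hg).isCompact
  rcases Set.eq_empty_or_nonempty {z | ε ≤ g z} with he | hne
  · refine ⟨1, one_pos, fun z _ => ?_⟩
    by_contra hcon
    exact Set.eq_empty_iff_forall_notMem.1 he z (not_lt.1 hcon)
  · obtain ⟨z₀, hz₀, hmin⟩ := hc.exists_isMinOn hne hf.continuousOn
    refine ⟨f z₀, lt_of_le_of_ne (hf0 z₀) fun h0 => ?_, fun z hz => ?_⟩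
    · have h1 : ε ≤ g z₀ := hz₀
      rw [h z₀ h0.symm] at h1
      linarith
    · by_contra hcon
      exact absurd (hmin (show z ∈ {z | ε ≤ g z} from not_lt.1 hcon)) (not_le.2 hz)

/-- Used in both directions on the square of [0,1], where the distance and the length of `e s * (e
t)⁻¹` have the same zeros. -/
theorem tendsto_zero_of_compact {Z : Type*} [TopologicalSpace Z] [CompactSpace Z] {f g : Z → ℝ}
    (hf : Continuous f) (hg : Continuous g) (hf0 : ∀ z, 0 ≤ f z) (hg0 : ∀ z, 0 ≤ g z)
    (h : ∀ z, f z = 0 → g z = 0) {u : ℕ → Z} (hu : Tendsto (fun n => f (u n)) atTop (𝓝 0)) :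
    Tendsto (fun n => g (u n)) atTop (𝓝 0) := by
  rw [Metric.tendsto_nhds]
  intro ε hε
  obtain ⟨δ, hδ, hfg⟩ := exists_lt_of_lt_of_compact hf hg hf0 h hε
  filter_upwards [hu.eventually_lt_const hδ] with n hn
  rw [Real.dist_eq, sub_zero, abs_of_nonneg (hg0 _)]
  exact hfg _ hn

/-- The sequence with partial products `x`. -/
def increments {A : Type*} [Group A] (x : ℕ → A) : ℕ → A
  | 0 => x 0
  | n + 1 => (x n)⁻¹ * x (n + 1)

theorem pp_increments {A : Type*} [Group A] (x : ℕ → A) (n : ℕ) :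
    pp (increments x) (n + 1) = x n := by
  induction n with
  | zero => simp [pp_succ, increments]
  | succ n ih => rw [pp_succ, ih, increments, mul_inv_cancel_left]

theorem e_iff_eStar_increments {A : Type*} [Group A] [TopologicalSpace A] [IsTopologicalGroup A]
    (x y : ℕ → A) : E A x y ↔ EStar A (increments x) (increments y) := by
  rw [eStar_iff_rat]
  simp only [rat, pp_increments]
  rfl

theorem continuous_increments {A : Type*} [Group A] [TopologicalSpace A] [IsTopologicalGroup A] :
    Continuous (increments : (ℕ → A) → ℕ → A) := by
  refine continuous_pi fun n => ?_
  rcases n with - | n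
  · exact continuous_apply 0
  · exact (continuous_apply n).inv.mul (continuous_apply (n + 1))

theorem continuous_pp {A : Type*} [Group A] [TopologicalSpace A] [IsTopologicalGroup A] (n : ℕ) :
    Continuous fun x : ℕ → A => pp x n := by
  induction n with
  | zero => exact continuous_const
  | succ n ih => exact ih.mul (continuous_apply n)

/-- The sequence `u 0, u 0 * c 0, u 1, u 1 * c 1, …`. -/
def interleave {A : Type*} [Group A] (u c : ℕ → A) (k : ℕ) : A :=
  if k % 2 = 0 then u (k / 2) else u (k / 2) * c (k / 2)

/-- The ratio at an odd position differs from the preceding one by a conjugate of `c n * (c' n)⁻¹`.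
The even positions thus test convergence for `u`, and the odd ones test that `c` and `c'` approach
each other. -/
theorem isCau_interleave {A : Type*} [Group A] (ν : InvLength A) (u c u' c' : ℕ → A) :
    (ν.IsCau fun k => interleave u c k * (interleave u' c' k)⁻¹) ↔
      (ν.IsCau fun k => u k * (u' k)⁻¹) ∧ Tendsto (fun k => ν (c k * (c' k)⁻¹)) atTop (𝓝 0) := by
  set r : ℕ → A := fun k => interleave u c k * (interleave u' c' k)⁻¹ with hr
  have h0 : ∀ n, r (2 * n) = u n * (u' n)⁻¹ := fun n => by simp [hr, interleave]
  have h1 : ∀ n, ν (r (2 * n + 1) * (r (2 * n))⁻¹) = ν (c n * (c' n)⁻¹) := fun n => by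
    have e1 : (2 * n + 1) / 2 = n := by omega
    have e2 : (2 * n + 1) % 2 = 1 := by omega
    rw [h0]
    refine ν.eq_of_conj (u n) ?_
    simp only [hr, interleave, e1, e2, one_ne_zero, if_false]
    group
  have h2 : StrictMono fun n => 2 * n := fun a b hab => by simp only; omega
  have h3 : (fun k => u k * (u' k)⁻¹) = fun n => r (2 * n) := funext fun n => (h0 n).symm
  rw [h3]
  constructor
  · intro h
    refine ⟨h.comp h2.tendsto_atTop, ?_⟩
    rw [Metric.tendsto_atTop]
    intro ε hε
    obtain ⟨N, hN⟩ := h.two hε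
    refine ⟨N, fun n hn => ?_⟩
    rw [Real.dist_eq, sub_zero, abs_of_nonneg (ν.map_nonneg _), ← h1]
    exact hN _ (by omega) _ (by omega)
  · rintro ⟨h, hc⟩
    have hstep : Tendsto (fun n => ν (r (2 * (n + 1)) * (r (2 * n))⁻¹)) atTop (𝓝 0) := by
      rw [Metric.tendsto_atTop]
      intro ε hε
      obtain ⟨N, hN⟩ := h.two hε
      refine ⟨N, fun n hn => ?_⟩
      rw [Real.dist_eq, sub_zero, abs_of_nonneg (ν.map_nonneg _)]
      exact hN _ (by omega) _ hn
    refine ν.isCau_of_blocks h2 (e := fun n => ν (c n * (c' n)⁻¹) +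
      ν (r (2 * (n + 1)) * (r (2 * n))⁻¹)) (by simpa using hc.add hstep) (fun n k hk1 hk2 => ?_) h
    have p1 := ν.map_nonneg (c n * (c' n)⁻¹)
    have p2 := ν.map_nonneg (r (2 * (n + 1)) * (r (2 * n))⁻¹)
    beta_reduce at hk1 hk2 ⊢
    obtain rfl | rfl | rfl : k = 2 * n ∨ k = 2 * n + 1 ∨ k = 2 * (n + 1) := by omega
    · simp only [mul_inv_cancel, InvLength.map_one]; linarith
    · rw [h1]; linarith
    · linarith

theorem borelReducible_of_isPreRigid {G : Type*} [Group G] [t : TopologicalSpace G]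
    [IsTopologicalGroup G] [PolishSpace G] (hG : IsTSI G)
    {Hm : ℕ → Type*} [∀ m, Group (Hm m)] [∀ m, TopologicalSpace (Hm m)]
    [∀ m, IsTopologicalGroup (Hm m)] [∀ m, PolishSpace (Hm m)]
    (hTSI : ∀ m, IsTSI (Hm m)) (H : Subgroup (∀ m, Hm m)) (hH : IsClosed (H : Set (∀ m, Hm m)))
    {W : ℕ → Subgroup G} {p : ∀ m, W m → Hm m} (hW : IsPreRigid H W p) (hWt : (⨅ m, W m) = ⊤)
    {e : unitInterval → H} (he : IsEmbedding e) : BorelReducible (E G) (E H) := by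
  have : PolishSpace H := hH.polishSpace
  obtain ⟨ν, hν⟩ := ((isTSI_pi hTSI).subgroup H).exists_isCompat
  obtain ⟨d, hd, hl, hr⟩ := hG
  subst hd
  obtain ⟨τ, hτc, hτ⟩ := exists_reduction_unitInterval G
  obtain ⟨-, hpc, -, -, S, hS, hred⟩ := hW
  have hSc : Continuous S := continuous_induced_rng.2 <| continuous_pi fun m =>
    ((hpc m).comp (continuous_subtype_val.subtype_mk _)).congr fun g => (hS g m).symm
  have hmem : ∀ g : G, g ∈ ⨅ m, W m := fun g => hWt ▸ Subgroup.mem_top g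
  -- The assumption that the intersection is all of G makes every increment an argument of `S`.
  let j : G →* ↥(⨅ m, W m) :=
    { toFun := fun g => ⟨g, hmem g⟩
      map_one' := rfl
      map_mul' := fun _ _ => rfl }
  have hj : Continuous j := continuous_id.subtype_mk _
  let u : (ℕ → G) → ℕ → H := fun x k => pp (omegaMap S fun n => j (increments x n)) (k + 1)
  let c : (ℕ → G) → ℕ → H := fun x k => e (τ (increments x) k)
  have huc : Continuous u := continuous_pi fun k => (continuous_pp (k + 1)).comp
    (continuous_pi fun n => hSc.comp (hj.comp ((continuous_apply n).comp continuous_increments)))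
  have hcc : Continuous c := continuous_pi fun k =>
    he.continuous.comp ((continuous_apply k).comp (hτc.comp continuous_increments))
  have hfc : Continuous fun x => interleave (u x) (c x) := by
    refine continuous_pi fun k => ?_
    have h1 := (continuous_apply (k / 2)).comp huc
    have h2 := (continuous_apply (k / 2)).comp hcc
    unfold interleave
    split_ifs
    · exact h1
    · exact h1.mul h2
  refine ⟨_, hfc.borel_measurable, fun x y => ?_⟩
  have hF : Continuous fun q : unitInterval × unitInterval => ν (e q.1 * (e q.2)⁻¹) :=
    hν.continuous.comp ((he.continuous.comp continuous_fst).mul (he.continuous.comp continuous_snd).inv)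
  have hdist : Continuous fun q : unitInterval × unitInterval => dist q.1 q.2 :=
    continuous_fst.dist continuous_snd
  have hF0 : ∀ q : unitInterval × unitInterval, ν (e q.1 * (e q.2)⁻¹) = 0 → dist q.1 q.2 = 0 := by
    intro q hq
    have := he.injective (hν.eq_of_forall_lt (a := e q.1) (b := e q.2) fun ε hε => hq ▸ hε)
    rw [this, dist_self]
  have hd0 : ∀ q : unitInterval × unitInterval, dist q.1 q.2 = 0 → ν (e q.1 * (e q.2)⁻¹) = 0 := by
    intro q hq
    rw [eq_of_dist_eq_zero hq, mul_inv_cancel, InvLength.map_one]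
  have hc : Tendsto (fun k => ν (c x k * (c y k)⁻¹)) atTop (𝓝 0) ↔
      EZero ↥(⨅ m, W m) (fun n => j (increments x n)) (fun n => j (increments y n)) := by
    have h1 : EZero ↥(⨅ m, W m) (fun n => j (increments x n)) (fun n => j (increments y n)) ↔
        EZero G (increments x) (increments y) := by
      change Tendsto _ _ _ ↔ Tendsto _ _ _
      rw [tendsto_subtype_rng]
      rfl
    rw [h1, eZero_iff_dist d rfl hl, hτ]
    exact ⟨tendsto_zero_of_compact (u := fun k => (τ (increments x) k, τ (increments y) k)) hF hdist
      (fun _ => ν.map_nonneg _) (fun _ => dist_nonneg) hF0,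
      tendsto_zero_of_compact (u := fun k => (τ (increments x) k, τ (increments y) k)) hdist hF
      (fun _ => dist_nonneg) (fun _ => ν.map_nonneg _) hd0⟩
  have hu : (ν.IsCau fun k => u x k * (u y k)⁻¹) ↔
      EStar H (omegaMap S fun n => j (increments x n)) (omegaMap S fun n => j (increments y n)) := by
    rw [hν.eStar_iff, ← InvLength.isCau_succ_iff (r := rat _ _)]
    rfl
  have hE : E G x y ↔ EStar ↥(⨅ m, W m) (fun n => j (increments x n))
      (fun n => j (increments y n)) := by
    rw [e_iff_eStar_increments]
    exact ⟨eStar_map j hj, eStar_map (⨅ m, W m).subtype continuous_subtype_val⟩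
  rw [hν.e_iff, isCau_interleave, hu, hc, hE]
  exact hred _ _

end TSIPolish

theorem theorem5 {G : Type*} [Group G] [TopologicalSpace G] [IsTopologicalGroup G] [PolishSpace G]
    (hG : TSIPolish.IsTSI G)
    {Hm : ℕ → Type*} [∀ m, Group (Hm m)] [∀ m, TopologicalSpace (Hm m)]
    [∀ m, IsTopologicalGroup (Hm m)] [∀ m, PolishSpace (Hm m)]
    (hTSI : ∀ m, TSIPolish.IsTSI (Hm m)) (hNSS : ∀ m, TSIPolish.IsStronglyNSS (Hm m))
    (H : Subgroup (∀ m, Hm m)) (hH : IsClosed (H : Set (∀ m, Hm m))) :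
    (TSIPolish.BorelReducible (TSIPolish.E G) (TSIPolish.E H) →
      ∃ (W : ℕ → Subgroup G) (p : ∀ m, W m → Hm m), TSIPolish.IsPreRigid H W p) ∧
    ((∃ (W : ℕ → Subgroup G) (p : ∀ m, W m → Hm m),
        TSIPolish.IsPreRigid H W p ∧ (⨅ m, W m) = ⊤) →
      (∃ f : unitInterval → H, IsEmbedding f) →
      TSIPolish.BorelReducible (TSIPolish.E G) (TSIPolish.E H)) :=
  ⟨TSIPolish.exists_isPreRigid hG hTSI hNSS H hH, fun ⟨_, _, hW, hWt⟩ ⟨_, he⟩ =>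
    TSIPolish.borelReducible_of_isPreRigid hG hTSI H hH hW hWt he⟩
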